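/- **Setting.** Graphs are finite, simple and undirected, with node features $x(u)\in\mathbb R^{d_x}$ and symmetric edge features $e(u,v)\in\mathbb R^{d_e}$, where $e(u,v)=0$ if $uv$ is not an edge. Fix $K\ge 0$ and put $$h^{(0)}(u,v)=\big(x(u),x(v),e(u,v),p(u,v)\big),\qquad p(u,v)=\big(I,\hat A,\hat A^2,\dots,\hat A^{K-1}\big)[u,v],\quad \hat A=D^{-1}A,$$ with $A$ the adjacency matrix and $D$ the degree matrix (rows of $\hat A$ at isolated nodes are $0$). A *standard 2-FWL GNN* has a number $L$ of layers, functions $\phi^{(l)},\Phi^{(l)},\Psi$ between spaces of real vectors, injective maps $\mathrm{AGG}$ from finite multisets of vectors to vectors, and computes, for all nodes $u,v$, $$h^{(l)}(u,v)=\Phi^{(l)}\Big(h^{(l-1)}(u,v),\mathrm{AGG}\{\!\!\{\phi^{(l)}(h^{(l-1)}(u,t),h^{(l-1)}(t,v)) : t\in \mathcal N(u,v)\}\!\!\}\Big),\quad \mathcal N(u,v)=V,$$ with graph representation $z_G=\Psi(\mathrm{AGG}\{\!\!\{h^{(L)}(u,v):u,v\in V\}\!\!\})$. A *biconnected component* is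 a maximal subgraph on at least three nodes that remains connected after the removal of any single node. A *Co-Sparsified 2-FWL GNN* starts from the same $h^{(0)}$ and uses the same update, with injective $\mathrm{AGG}$, but only for pairs $u,v$ in the same connected component and with $\mathcal N(u,v)$ replaced by $\mathcal N_{\mathrm{sp}}(u,v)$, where $\mathcal N_{\mathrm{sp}}(u,u)$ is the connected component of $u$ and, for $u\ne v$, $\mathcal N_{\mathrm{sp}}(u,v)$ consists of $u$, $v$ and all $t\notin\{u,v\}$ such that $u,t,v$ lie in a common biconnected component. Each connected component $C$ gets $$z_C=\varPhi\big(\mathrm{AGG}\{\!\!\{h^{(L)}(u,u):u\in C\}\!\!\},\ \mathrm{AGG}\{\!\!\{h^{(L)}(u,v):u,v\in C,\ u\ne v\}\!\!\}\big),$$ and $z_G=z_C$ if $G$ is connected with single component $C$, while otherwise $z_G=\Psi(\mathrm{AGG}\{\!\!\{z_C: C \text{ a connected component of } G\}\!\!\})$. A model *detects* a finite graph $Q$ on a class $\mathcal G$ of graphs if $z_G\neq z_H$ whenever $G,H\in\mathcal G$, $G$ contains $Q$ as a (not necessarily induced) subgraph and $H$ does not. It *distinguishes* $G$ and $H$ if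 $z_G\ne z_H$. The initialization is *consistent* on $\mathcal G$ if, for all pairs of nodes of graphs in $\mathcal G$, the value $h^{(0)}(u,v)$ determines whether $u=v$ and whether $uv$ is an edge. (This always holds for $K\ge2$, and for $K=1$ if all edges have non-zero features.) **Theorem.** Let $\mathcal G$ be a class of graphs with a common upper bound on the number of nodes, and assume that the initialization is consistent on $\mathcal G$. 1. For every finite graph $Q$, some Co-Sparsified 2-FWL GNN detects $Q$ on $\mathcal G$ if and only if some standard 2-FWL GNN detects $Q$ on $\mathcal G$. 2. For all $G,H\in\mathcal G$, in particular for non-isomorphic ones, some Co-Sparsified 2-FWL GNN distinguishes $G$ and $H$ if and only if some standard 2-FWL GNN does. -/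

import Mathlib

/-- Real feature vectors of dimension `d`. -/
abbrev Vec (d : ℕ) : Type := Fin d → ℝ

/-- A finite undirected graph with node features in `ℝ^dx` and (symmetric) edge features in
`ℝ^de`, where the edge feature is zero if there is no edge. -/
structure AttrGraph (dx de : ℕ) where
  V : Type
  [fintypeV : Fintype V]
  graph : SimpleGraph V
  x : V → Vec dx
  e : V → V → Vec de
  e_symm : ∀ u v, e u v = e v u
  e_zero : ∀ u v, ¬ graph.Adj u v → e u v = 0

attribute [instance] AttrGraph.fintypeV

section Connectivity

variable {V : Type}

/-- The subgraph on `B` has at least three nodes and remains connected after removing any single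
node. (With at least three nodes, this forces it to be connected itself.) -/
def IsBiconnected (G : SimpleGraph V) (B : Set V) : Prop :=
  3 ≤ B.ncard ∧ ∀ c ∈ B, (G.induce (B \ {c})).Connected

/-- A biconnected component, given by its node set. A maximal biconnected subgraph is induced, so
it is the same to maximize over node sets. -/
def IsBlock (G : SimpleGraph V) (B : Set V) : Prop :=
  Maximal (IsBiconnected G) B

/-- `((u,t),(t,v))` belongs to the co-sparsified neighbor set of `(u,v)`. The set is empty if `u`
and `v` lie in different connected components. For a self-pair `u = v` it consists of
`((u,u),(u,u))` and all `((u,t),(t,u))` with `t ≠ u` in the component of `u`. For `u ≠ v` it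
consists of the 2-node interactions `((u,u),(u,v))`, `((u,v),(v,v))` and the 3-node interactions
with `u`, `t`, `v` distinct and in a common biconnected component. -/
def SpInteraction (G : SimpleGraph V) (u t v : V) : Prop :=
  G.Reachable u v ∧
    ((u = v ∧ G.Reachable u t) ∨
     (u ≠ v ∧ (t = u ∨ t = v ∨
       (t ≠ u ∧ t ≠ v ∧ ∃ B : Set V, IsBlock G B ∧ u ∈ B ∧ t ∈ B ∧ v ∈ B))))

open Classical in
/-- The co-sparsified neighbor set of `(u,v)`, as the set of its intermediate nodes `t`. -/
noncomputable def spNbr [Fintype V] (G : SimpleGraph V) (u v : V) : Finset V :=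
  Finset.univ.filter fun t => SpInteraction G u t v

open Classical in
/-- The random walk matrix `D⁻¹ A` (with zero rows at isolated nodes). -/
noncomputable def randomWalk [Fintype V] (G : SimpleGraph V) : Matrix V V ℝ :=
  Matrix.diagonal (fun v => (G.degree v : ℝ)⁻¹) * G.adjMatrix ℝ

open Classical in
/-- Relative random walk probabilities: the entries at `(u,v)` of the first `K` powers
`I, D⁻¹A, (D⁻¹A)², …`. -/
noncomputable def rrwp [Fintype V] (G : SimpleGraph V) (K : ℕ) (u v : V) : Vec K :=
  fun k => (randomWalk G ^ (k : ℕ)) u v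

end Connectivity

/-- The space of initial representations `(x(u), x(v), e(u,v), p(u,v))`. -/
abbrev InitRep (dx de K : ℕ) : Type := Vec dx × Vec dx × Vec de × Vec K

/-- The initial representation of a pair of nodes, shared by both kinds of model. -/
noncomputable def initRep {dx de : ℕ} (K : ℕ) (G : AttrGraph dx de) (u v : G.V) :
    InitRep dx de K :=
  (G.x u, G.x v, G.e u v, rrwp G.graph K u v)

/-- Across the graphs of the class, the initial representation of a pair determines whether it is
a self-pair and whether it is an edge. -/
def ConsistentInit {dx de : ℕ} (K : ℕ) (𝒢 : Set (AttrGraph dx de)) : Prop :=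
  ∀ G ∈ 𝒢, ∀ H ∈ 𝒢, ∀ (u v : G.V) (u' v' : H.V), initRep K G u v = initRep K H u' v' →
    ((u = v ↔ u' = v') ∧ (G.graph.Adj u v ↔ H.graph.Adj u' v'))

/-- The space of layer-`l` pair representations: the initial ones for `l = 0`, then real vectors
whose dimension may depend on the layer. -/
def PairRep (I : Type) (width : ℕ → ℕ) : ℕ → Type
  | 0 => I
  | l + 1 => Vec (width l)

/-- The message passing part of a model: number of layers, message functions `φ`, injective
aggregations `AGG` and update functions `Φ`. Index `l` gives the map from layer `l` to layer
`l + 1`; only the indices below `depth` are used. -/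
structure MessagePassing (I : Type) where
  depth : ℕ
  width : ℕ → ℕ
  msgDim : ℕ → ℕ
  aggDim : ℕ → ℕ
  φ : ∀ l, PairRep I width l → PairRep I width l → Vec (msgDim l)
  agg : ∀ l, Multiset (Vec (msgDim l)) → Vec (aggDim l)
  agg_injective : ∀ l, Function.Injective (agg l)
  Φ : ∀ l, PairRep I width l → Vec (aggDim l) → Vec (width l)

namespace MessagePassing

variable {I V : Type} [Fintype V]

/-- Standard 2-FWL message passing: every pair aggregates over all intermediate nodes. -/
def stdRep (M : MessagePassing I) (h₀ : V → V → I) : (l : ℕ) → V → V → PairRep I M.width l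
  | 0 => h₀
  | l + 1 => fun u v =>
      M.Φ l (M.stdRep h₀ l u v)
        (M.agg l ((Finset.univ : Finset V).val.map fun t =>
          M.φ l (M.stdRep h₀ l u t) (M.stdRep h₀ l t v)))

open Classical in
/-- Co-sparsified message passing: a pair in one connected component aggregates over its
co-sparsified neighbor set. Pairs in different components are not updated; the value `0` stored
for them in layers `l ≥ 1` is never read, by a message into a connected pair or by a readout. -/
noncomputable def spRep (M : MessagePassing I) (G : SimpleGraph V) (h₀ : V → V → I) :
    (l : ℕ) → V → V → PairRep I M.width l
  | 0 => h₀
  | l + 1 => fun u v =>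
      if G.Reachable u v then
        M.Φ l (M.spRep G h₀ l u v)
          (M.agg l ((spNbr G u v).val.map fun t =>
            M.φ l (M.spRep G h₀ l u t) (M.spRep G h₀ l t v)))
      else (0 : Vec (M.width l))

end MessagePassing

/-- A standard 2-FWL GNN with its graph-level readout over all node pairs. -/
structure StandardGNN (dx de K : ℕ) extends MessagePassing (InitRep dx de K) where
  readDim : ℕ
  outDim : ℕ
  readAgg : Multiset (PairRep (InitRep dx de K) width depth) → Vec readDim
  readAgg_injective : Function.Injective readAgg
  Ψ : Vec readDim → Vec outDim

/-- The graph representation `z_G = Ψ(AGG {{ h(u,v) | u, v ∈ V }})`. -/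
noncomputable def StandardGNN.out {dx de K : ℕ} (M : StandardGNN dx de K)
    (G : AttrGraph dx de) : Vec M.outDim :=
  M.Ψ (M.readAgg ((Finset.univ : Finset (G.V × G.V)).val.map fun p =>
    M.stdRep (initRep K G) M.depth p.1 p.2))

/-- A Co-Sparsified 2-FWL GNN with its component-level and graph-level readouts. -/
structure CoSparsifiedGNN (dx de K : ℕ) extends MessagePassing (InitRep dx de K) where
  pairDim : ℕ
  compDim : ℕ
  outDim : ℕ
  pairAgg : Multiset (PairRep (InitRep dx de K) width depth) → Vec pairDim
  pairAgg_injective : Function.Injective pairAgg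
  compOut : Vec pairDim → Vec pairDim → Vec outDim
  compAgg : Multiset (Vec outDim) → Vec compDim
  compAgg_injective : Function.Injective compAgg
  Ψ : Vec compDim → Vec outDim

namespace CoSparsifiedGNN

variable {dx de K : ℕ}

open Classical in
/-- The representation `z_C` of a connected component `C`: two parallel readouts, over the
self-pairs and over the off-diagonal pairs of `C`. -/
noncomputable def compRep (M : CoSparsifiedGNN dx de K) (G : AttrGraph dx de)
    (C : G.graph.ConnectedComponent) : Vec M.outDim :=
  M.compOut
    (M.pairAgg (((Finset.univ : Finset G.V).filter fun u => u ∈ C.supp).val.map fun u =>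
      M.spRep G.graph (initRep K G) M.depth u u))
    (M.pairAgg (((Finset.univ : Finset (G.V × G.V)).filter fun p =>
        p.1 ∈ C.supp ∧ p.2 ∈ C.supp ∧ p.1 ≠ p.2).val.map fun p =>
      M.spRep G.graph (initRep K G) M.depth p.1 p.2))

open Classical in
/-- The graph representation: `z_C` if `G` is connected with single component `C`, and otherwise
`Ψ(AGG {{ z_C | C a connected component of G }})`. -/
noncomputable def out (M : CoSparsifiedGNN dx de K) (G : AttrGraph dx de) : Vec M.outDim :=
  if h : G.graph.Connected then
    M.compRep G (G.graph.connectedComponentMk h.nonempty.some)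
  else
    M.Ψ (M.compAgg
      ((Finset.univ.image G.graph.connectedComponentMk).val.map fun C => M.compRep G C))

end CoSparsifiedGNN

/-- The graph representation `z` detects `Q` on the class `𝒢`: it differs between any graph of the
class that contains `Q` as a (not necessarily induced) subgraph and any that does not. -/
def Detects {dx de : ℕ} {α : Type} {W : Type*} (z : AttrGraph dx de → α) (Q : SimpleGraph W)
    (𝒢 : Set (AttrGraph dx de)) : Prop :=
  ∀ G ∈ 𝒢, ∀ H ∈ 𝒢, Q.IsContained G.graph → ¬ Q.IsContained H.graph → z G ≠ z H

/-!
Both architectures contain a universal model, all of whose functions are injective, and running it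
for as many rounds as there are pairs of pairs of vertices makes the equality of its colors stable.
It therefore suffices that each of the two stable colorings carries the information of the other.

A stable 2-FWL coloring determines the numbers of walks between the ends of a pair. Decomposing
walks at their first visit to a vertex `w`, it determines whether `w` separates `u` from `v`, hence
whether `u` and `v` lie in a common block, hence the co-sparsified neighborhood.

Conversely, give a connected pair `(u, v)` the colors of its ends together with the sequence of
co-sparsified colors along the chain of cut vertices between `u` and `v`. This coloring is stable
under 2-FWL: moving the first vertex along the chain only changes how the chain to a third vertex
begins, in a way read off from the side of the cut vertex on which that vertex lies. It refines the
initialization, because the random walk from `u` to `v` splits at its first visit to a cut vertex.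
Chains can be read from either end, because the random walk is reversible and so the color of
`(u, v)` determines that of `(v, u)`.
-/

/-! ### Separation and blocks -/

section Separation

variable {V : Type*} {G : SimpleGraph V} {r s u v w x : V}

/-- Some walk from `u` to `v` avoids the vertex `w`; in particular `w` is neither `u` nor `v`. -/
def ReachableAvoiding (G : SimpleGraph V) (w u v : V) : Prop :=
  ∃ p : G.Walk u v, w ∉ p.support

/-- Betweenness with respect to cut vertices: `u` and `v` are connected, and every walk from `u` to
`v` passes through `w`. The end vertices `u` and `v` are themselves between `u` and `v`. -/
def Between (G : SimpleGraph V) (u w v : V) : Prop :=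
  G.Reachable u v ∧ ¬ ReachableAvoiding G w u v

/-- Two distinct connected vertices with no third vertex between them, that is, two vertices which
are adjacent or lie in a common block. -/
structure Unseparated (G : SimpleGraph V) (u v : V) : Prop where
  ne : u ≠ v
  reachable : G.Reachable u v
  avoiding : ∀ s, s ≠ u → s ≠ v → ReachableAvoiding G s u v

namespace ReachableAvoiding

theorem ne_left (h : ReachableAvoiding G w u v) : w ≠ u := by
  rintro rfl
  exact h.elim fun p hp => hp p.start_mem_support

theorem ne_right (h : ReachableAvoiding G w u v) : w ≠ v := by
  rintro rfl
  exact h.elim fun p hp => hp p.end_mem_support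

theorem reachable (h : ReachableAvoiding G w u v) : G.Reachable u v := ⟨h.choose⟩

theorem refl (h : w ≠ u) : ReachableAvoiding G w u u := ⟨.nil, by simpa using h⟩

theorem symm (h : ReachableAvoiding G w u v) : ReachableAvoiding G w v u := by
  obtain ⟨p, hp⟩ := h
  exact ⟨p.reverse, by simpa using hp⟩

theorem trans (h : ReachableAvoiding G w u v) (h' : ReachableAvoiding G w v x) :
    ReachableAvoiding G w u x := by
  obtain ⟨p, hp⟩ := h
  obtain ⟨q, hq⟩ := h'
  exact ⟨p.append q, by simp [SimpleGraph.Walk.mem_support_append_iff, hp, hq]⟩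

theorem of_adj (h : G.Adj u v) (hu : w ≠ u) (hv : w ≠ v) : ReachableAvoiding G w u v :=
  ⟨h.toWalk, by simp [hu, hv]⟩

end ReachableAvoiding

theorem reachableAvoiding_or (h : G.Reachable u w) (hne : w ≠ x) :
    ReachableAvoiding G x u w ∨ ReachableAvoiding G w u x := by
  obtain ⟨p⟩ := h
  induction p with
  | nil => exact .inl (.refl hne.symm)
  | @cons a b c hab _ ih =>
    by_cases hx : x = a
    · subst hx; exact .inr (.refl hne)
    by_cases hw : c = a
    · subst hw; exact .inl (.refl hx)
    exact (ih hne).imp (fun h => .trans (.of_adj hab hx h.ne_left) h)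
      fun h => .trans (.of_adj hab hw h.ne_left) h

namespace Between

theorem right (h : G.Reachable u v) : Between G u v v := ⟨h, fun h' => h'.ne_right rfl⟩

theorem symm (h : Between G u w v) : Between G v w u := ⟨h.1.symm, fun h' => h.2 h'.symm⟩

theorem reachable_left (h : Between G u w v) : G.Reachable u w := by
  classical
  obtain ⟨p⟩ := h.1
  exact ⟨p.takeUntil w (by_contra fun hw => h.2 ⟨p, hw⟩)⟩

theorem reachable_right (h : Between G u w v) : G.Reachable w v := h.symm.reachable_left.symm

theorem avoiding_left (h : Between G u w v) (hne : w ≠ u) : ReachableAvoiding G u w v := by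
  by_cases hv : w = v
  · subst hv; exact .refl hne.symm
  by_cases hu : u = v
  · subst hu; exact absurd (.refl hne) h.2
  exact ((reachableAvoiding_or h.1.symm hne.symm).resolve_left fun h' => h.2 h'.symm).symm

theorem trans (h : Between G u r s) (h' : Between G u s v) : Between G u r v := by
  refine ⟨h'.1, fun hr => ?_⟩
  by_cases hrs : s = r
  · subst hrs; exact h'.2 hr
  have hsr : ReachableAvoiding G s u r := (reachableAvoiding_or h.1 hrs).resolve_left h.2
  exact (reachableAvoiding_or h'.reachable_right.symm hrs).elim (fun h₁ => h.2 (hr.trans h₁))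
    fun h₁ => h'.2 (hsr.trans h₁.symm)

theorem of_reachableAvoiding (h : Between G u w v) (ht : ReachableAvoiding G w u s) :
    Between G s w v :=
  ⟨ht.reachable.symm.trans h.1, fun h' => h.2 (ht.trans h')⟩

theorem right_of_between (h : Between G u x w) (h' : Between G u w v) : Between G x w v := by
  refine ⟨h.reachable_right.trans h'.reachable_right, fun hw => h'.2 ?_⟩
  exact ((reachableAvoiding_or h.reachable_left hw.ne_left.symm).resolve_right h.2).trans hw

end Between

theorem between_iff_of_between (hr : G.Reachable u w) (h : Between G w x v) (hne : x ≠ w) :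
    Between G u w x ↔ Between G u w v :=
  ⟨fun hb => ⟨hr.trans h.1, fun hv => hb.2 (hv.trans (h.avoiding_left hne).symm)⟩,
    fun hb => ⟨hr.trans h.reachable_left, fun hx => hb.2 (hx.trans (h.avoiding_left hne))⟩⟩

namespace Unseparated

theorem symm (h : Unseparated G u v) : Unseparated G v u :=
  ⟨h.ne.symm, h.reachable.symm, fun s h₁ h₂ => (h.avoiding s h₂ h₁).symm⟩

theorem of_adj (h : G.Adj u v) : Unseparated G u v :=
  ⟨h.ne, h.reachable, fun _ => .of_adj h⟩

theorem between_iff (h : Unseparated G u w) (h' : Unseparated G w x) (hx : x ≠ u) :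
    Between G u w x ↔ ¬ Unseparated G u x := by
  refine ⟨fun hb hu => hb.2 (hu.avoiding w h.ne.symm h'.ne), fun hn => ?_⟩
  have hr : G.Reachable u x := h.reachable.trans h'.reachable
  refine ⟨hr, fun hw => hn ⟨hx.symm, hr, fun s hs hs' => ?_⟩⟩
  by_cases hsw : s = w
  · subst hsw; exact hw
  · exact (h.avoiding s hs hsw).trans (h'.avoiding s hsw hs')

theorem eq_of_between (h : Unseparated G u w) (h' : Unseparated G u x) (hw : Between G u w v)
    (hx : Between G u x v) : w = x := by
  by_contra hne
  rcases reachableAvoiding_or (hw.1.symm.trans h.reachable) hne with h₁ | h₁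
  · exact hx.2 ((h.avoiding x h'.ne.symm (Ne.symm hne)).trans h₁.symm)
  · exact hw.2 ((h'.avoiding w h.ne.symm hne).trans h₁.symm)

end Unseparated

theorem exists_between_of_not_unseparated (h : G.Reachable u v) (hne : u ≠ v)
    (hn : ¬ Unseparated G u v) : ∃ w, w ≠ u ∧ w ≠ v ∧ Between G u w v := by
  by_contra! hcon
  exact hn ⟨hne, h, fun w hu hv => by_contra fun h' => hcon w hu hv ⟨h, h'⟩⟩

/-- The vertices between `u` and `v`; the measure for inductions along the cut vertices. -/
def cutVerts (G : SimpleGraph V) (u v : V) : Set V := {w | Between G u w v}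

theorem cutVerts_comm : cutVerts G u v = cutVerts G v u :=
  Set.ext fun _ => ⟨.symm, .symm⟩

theorem Between.cutVerts_ssubset_left (h : Between G u w v) (hne : w ≠ v) :
    cutVerts G u w ⊂ cutVerts G u v := by
  refine ⟨fun r hr => hr.trans h, fun hsub => ?_⟩
  have hv : Between G u v w := hsub (Between.right h.1)
  exact (reachableAvoiding_or h.reachable_left hne).elim hv.2 h.2

theorem Between.cutVerts_ssubset_right (h : Between G u w v) (hne : w ≠ u) :
    cutVerts G w v ⊂ cutVerts G u v := by
  rw [cutVerts_comm, cutVerts_comm (u := u)]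
  exact h.symm.cutVerts_ssubset_left hne

variable [Finite V]

theorem exists_unseparated_between (h : G.Reachable u v) (hne : u ≠ v) :
    ∃ w, Unseparated G u w ∧ Between G u w v := by
  induction hn : cutVerts G u v using WellFoundedLT.induction generalizing v with
  | _ _ ih =>
    by_cases hN : Unseparated G u v
    · exact ⟨v, hN, .right h⟩
    obtain ⟨s, hsu, hsv, hb⟩ := exists_between_of_not_unseparated h hne hN
    obtain ⟨w, hw, hws⟩ := ih _ (hn ▸ hb.cutVerts_ssubset_left hsv) hb.reachable_left hsu.symm rfl
    exact ⟨w, hw, hws.trans hb⟩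

theorem cutVerts_induction {motive : V → Prop} (h : G.Reachable u v) (base : motive v)
    (step : ∀ u w, Unseparated G u w → Between G u w v → motive w → motive u) : motive u := by
  induction hn : cutVerts G u v using WellFoundedLT.induction generalizing u with
  | _ _ ih =>
    by_cases huv : u = v
    · exact huv ▸ base
    obtain ⟨w, hw, hb⟩ := exists_unseparated_between h huv
    exact step u w hw hb
      (ih _ (hn ▸ hb.cutVerts_ssubset_right hw.ne.symm) hb.reachable_right rfl)

end Separation

section Blocks

open SimpleGraph (Walk)

variable {V : Type*} {G : SimpleGraph V} {B : Set V} {t u v w : V}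

theorem reachableAvoiding_or_of_mem_path {p : G.Walk u v} (hp : p.IsPath) (ht : t ∈ p.support)
    (hw : w ≠ t) : ReachableAvoiding G w u t ∨ ReachableAvoiding G w t v := by
  classical
  by_contra! hcon
  have hmem : w ∈ (p.takeUntil t ht).support := by_contra fun h => hcon.1 ⟨_, h⟩
  have hmem' : w ∈ (p.dropUntil t ht).support := by_contra fun h => hcon.2 ⟨_, h⟩
  have hnodup := hp.support_nodup
  rw [← p.take_spec ht, Walk.support_append, List.nodup_append] at hnodup
  rw [← Walk.cons_tail_support, List.mem_cons] at hmem'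
  exact hnodup.2.2 _ hmem _ (hmem'.resolve_left hw) rfl

theorem mem_of_mem_path_of_maximal (hB : Maximal (fun B : Set V => B.Pairwise (Unseparated G)) B)
    (hu : u ∈ B) (hv : v ∈ B) {p : G.Walk u v} (hp : p.IsPath) (ht : t ∈ p.support) : t ∈ B := by
  classical
  by_contra htB
  obtain ⟨s, hs, hst⟩ : ∃ s ∈ B, ¬ Unseparated G s t := by
    by_contra! hcon
    refine htB (hB.2 (y := insert t B) ?_ (Set.subset_insert _ _) (Set.mem_insert _ _))
    exact hB.1.insert fun b hb _ => ⟨(hcon b hb).symm, hcon b hb⟩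
  have hreach : ∀ a ∈ B, ∀ b ∈ B, G.Reachable a b := fun a ha b hb =>
    (eq_or_ne a b).elim (fun h => h ▸ .refl _) fun h => (hB.1 ha hb h).reachable
  obtain ⟨w, hws, hwt, hw⟩ := exists_between_of_not_unseparated
    ((hreach s hs u hu).trans ⟨p.takeUntil t ht⟩) (fun h => htB (h ▸ hs)) hst
  have hcut : ∀ a ∈ B, ¬ ReachableAvoiding G w a t := by
    intro a ha hat
    by_cases hsa : s = a
    · exact hw.2 (hsa ▸ hat)
    · exact hw.2 (((hB.1 hs ha hsa).avoiding w hws hat.ne_left).trans hat)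
  exact (reachableAvoiding_or_of_mem_path hp ht hwt).elim (hcut u hu) fun h => hcut v hv h.symm

theorem exists_maximal_pairwise_unseparated [Finite V] {A : Set V}
    (hA : A.Pairwise (Unseparated G)) :
    ∃ B, A ⊆ B ∧ Maximal (fun B : Set V => B.Pairwise (Unseparated G)) B :=
  Finite.exists_le_maximal (p := fun B : Set V => B.Pairwise (Unseparated G)) hA

theorem Unseparated.exists_of_not_adj [Finite V] (h : Unseparated G u v) (hadj : ¬ G.Adj u v) :
    ∃ t, Unseparated G u t ∧ Unseparated G t v := by
  classical
  have hA : ({u, v} : Set V).Pairwise (Unseparated G) :=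
    Set.pairwise_pair.2 fun _ => ⟨h, h.symm⟩
  obtain ⟨B, hAB, hB⟩ := exists_maximal_pairwise_unseparated hA
  have hu : u ∈ B := hAB (by simp)
  have hv : v ∈ B := hAB (by simp)
  obtain ⟨p, hp⟩ := h.reachable.exists_isPath
  cases p with
  | nil => exact absurd rfl h.ne
  | @cons _ t _ hut q =>
    have ht : t ∈ B := mem_of_mem_path_of_maximal hB hu hv hp (by simp)
    exact ⟨t, .of_adj hut, hB.1 ht hv (by rintro rfl; exact hadj hut)⟩

end Blocks

section Biconnected

open SimpleGraph (Embedding Walk)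

variable {V : Type} {G : SimpleGraph V} {B : Set V} {s t u v : V}

theorem IsBiconnected.reachableAvoiding {c : V} (hB : IsBiconnected G B) (hc : c ∈ B)
    (hu : u ∈ B \ {c}) (hv : v ∈ B \ {c}) (hs : s ∉ B \ {c}) : ReachableAvoiding G s u v := by
  obtain ⟨p⟩ := (hB.2 c hc).preconnected ⟨u, hu⟩ ⟨v, hv⟩
  refine ⟨p.map (Embedding.induce (G := G) (B \ {c})).toHom, fun hm => ?_⟩
  obtain ⟨⟨y, hy⟩, -, rfl⟩ := List.mem_map.1 ((congrArg (s ∈ ·) (Walk.support_map _ p)).mp hm)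
  exact hs hy

theorem IsBiconnected.unseparated (hB : IsBiconnected G B) (hu : u ∈ B) (hv : v ∈ B)
    (hne : u ≠ v) : Unseparated G u v := by
  obtain ⟨c, hc, hcuv⟩ : ∃ c ∈ B, c ∉ ({u, v} : Set V) :=
    Set.exists_mem_notMem_of_ncard_lt_ncard (by rw [Set.ncard_pair hne]; exact hB.1)
  rw [Set.mem_insert_iff, Set.mem_singleton_iff, not_or] at hcuv
  have hc' : ∀ s ∉ B \ {c}, ReachableAvoiding G s u v := fun s =>
    hB.reachableAvoiding hc ⟨hu, Ne.symm hcuv.1⟩ ⟨hv, Ne.symm hcuv.2⟩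
  refine ⟨hne, (hc' c (by simp)).reachable, fun s hsu hsv => ?_⟩
  by_cases hs : s ∈ B
  · exact hB.reachableAvoiding hs ⟨hu, hsu.symm⟩ ⟨hv, hsv.symm⟩ (by simp)
  · exact hc' s fun h => hs h.1

theorem isBiconnected_of_maximal (hB : Maximal (fun B : Set V => B.Pairwise (Unseparated G)) B)
    (h3 : 3 ≤ B.ncard) : IsBiconnected G B := by
  classical
  refine ⟨h3, fun c hc => SimpleGraph.connected_iff _ |>.2 ⟨?_, ?_⟩⟩
  · rintro ⟨a, ha, hac⟩ ⟨b, hb, hbc⟩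
    obtain ⟨p, hp⟩ : ReachableAvoiding G c a b := by
      by_cases h : a = b
      · subst h; exact .refl (Ne.symm hac)
      · exact (hB.1 ha hb h).avoiding c (Ne.symm hac) (Ne.symm hbc)
    refine ⟨p.bypass.induce (B \ {c}) fun x hx =>
      ⟨mem_of_mem_path_of_maximal hB ha hb p.bypass_isPath hx, ?_⟩⟩
    rintro rfl
    exact hp (p.support_bypass_subset_support hx)
  · obtain ⟨a, ha, hac⟩ : ∃ a ∈ B, a ∉ ({c} : Set V) :=
      Set.exists_mem_notMem_of_ncard_lt_ncard (by rw [Set.ncard_singleton]; omega)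
    exact ⟨⟨a, ha, hac⟩⟩

theorem mem_spNbr [Fintype V] : t ∈ spNbr G u v ↔ SpInteraction G u t v := by
  simp [spNbr]

variable [Finite V]

theorem exists_isBlock_iff (htu : t ≠ u) (htv : t ≠ v) (huv : u ≠ v) :
    (∃ B : Set V, IsBlock G B ∧ u ∈ B ∧ t ∈ B ∧ v ∈ B) ↔
      Unseparated G u t ∧ Unseparated G t v ∧ Unseparated G u v := by
  constructor
  · rintro ⟨B, hB, hu, ht, hv⟩
    exact ⟨hB.1.unseparated hu ht htu.symm, hB.1.unseparated ht hv htv,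
      hB.1.unseparated hu hv huv⟩
  · rintro ⟨hut, htv', huv'⟩
    have hA : ({u, t, v} : Set V).Pairwise (Unseparated G) := by
      have hp : ({t, v} : Set V).Pairwise (Unseparated G) :=
        Set.pairwise_pair.2 fun _ => ⟨htv', htv'.symm⟩
      refine hp.insert ?_
      rintro b (rfl | rfl) -
      exacts [⟨hut, hut.symm⟩, ⟨huv', huv'.symm⟩]
    obtain ⟨B, hAB, hB⟩ := exists_maximal_pairwise_unseparated hA
    have hcard : 3 ≤ B.ncard := by
      rw [← Set.ncard_eq_three.2 ⟨u, t, v, htu.symm, huv, htv, rfl⟩]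
      exact Set.ncard_le_ncard hAB
    obtain ⟨B', hBB', hB'⟩ := Finite.exists_le_maximal (isBiconnected_of_maximal hB hcard)
    exact ⟨B', hB', hBB' (hAB (by simp)), hBB' (hAB (by simp)), hBB' (hAB (by simp))⟩

theorem spInteraction_iff : SpInteraction G u t v ↔ G.Reachable u v ∧
    ((u = v ∧ G.Reachable u t) ∨ (u ≠ v ∧
      (t = u ∨ t = v ∨ (Unseparated G u t ∧ Unseparated G t v ∧ Unseparated G u v)))) := by
  refine and_congr_right fun _ => or_congr_right (and_congr_right fun huv => ?_)
  by_cases htu : t = u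
  · simp [htu]
  by_cases htv : t = v
  · simp [htv]
  simp only [htu, htv, ne_eq, not_false_eq_true, true_and, false_or]
  exact exists_isBlock_iff htu htv huv

namespace SpInteraction

theorem reachable_left (h : SpInteraction G u t v) : G.Reachable u t := by
  obtain ⟨h, ⟨-, h'⟩ | ⟨-, rfl | rfl | h'⟩⟩ := spInteraction_iff.1 h
  exacts [h', .refl _, h, h'.1.reachable]

theorem reachable_right (h : SpInteraction G u t v) : G.Reachable t v :=
  h.reachable_left.symm.trans h.1

theorem symm (h : SpInteraction G u t v) : SpInteraction G v t u := by
  obtain ⟨hr, ⟨rfl, -⟩ | ⟨hne, h'⟩⟩ := spInteraction_iff.1 h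
  · exact h
  · refine spInteraction_iff.2 ⟨hr.symm, .inr ⟨hne.symm, ?_⟩⟩
    rcases h' with h' | h' | ⟨h₁, h₂, h₃⟩
    exacts [.inr (.inl h'), .inl h', .inr (.inr ⟨h₂.symm, h₁.symm, h₃.symm⟩)]

end SpInteraction

end Biconnected

/-! ### First passage decomposition of walks -/

section FirstPassage

open Matrix

variable {V V' R : Type*} [Fintype V] [DecidableEq V] [Fintype V'] [DecidableEq V'] [Semiring R]

theorem add_pow_eq_pow_add_sum (a b : R) (k : ℕ) :
    (a + b) ^ k = a ^ k + ∑ j ∈ Finset.range k, a ^ j * b * (a + b) ^ (k - (j + 1)) := by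
  induction k with
  | zero => simp
  | succ k ih =>
    calc (a + b) ^ (k + 1) = a * (a + b) ^ k + b * (a + b) ^ k := by rw [pow_succ', add_mul]
      _ = _ := by
        nth_rewrite 1 [ih]
        simp only [Finset.sum_range_succ', mul_add, Finset.mul_sum, pow_succ', mul_assoc,
          add_assoc, Nat.add_sub_add_right, pow_zero, one_mul, Nat.sub_zero]

/-- Decomposition by the first visit to `w`: the powers of `P.updateRow w 0` count the ways to
arrive without having left `w` before. -/
theorem pow_apply_eq_updateRow_pow_add_sum (P : Matrix V V R) (u v w : V) (k : ℕ) :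
    (P ^ k) u v = (P.updateRow w 0 ^ k) u v +
      ∑ j ∈ Finset.range k, (P.updateRow w 0 ^ j) u w * (P ^ (k - j)) w v := by
  set E : Matrix V V R := updateRow 0 w (P w)
  have hP : P.updateRow w 0 + E = P := by
    ext x y
    by_cases hx : x = w <;> simp [E, updateRow_apply, hx]
  have hE : ∀ (A B : Matrix V V R), (A * E * B) u v = A u w * (P * B) w v := by
    intro A B
    simp [E, mul_assoc, mul_apply, updateRow_apply, Finset.mul_sum]
  have h := congrFun (congrFun (add_pow_eq_pow_add_sum (P.updateRow w 0) E k) u) v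
  rw [hP, Matrix.add_apply, Matrix.sum_apply] at h
  rw [h]
  refine congrArg _ (Finset.sum_congr rfl fun j hj => ?_)
  rw [hE, ← pow_succ', show k - (j + 1) + 1 = k - j by have := Finset.mem_range.1 hj; omega]

variable [IsCancelAdd R] {P : Matrix V V R} {P' : Matrix V' V' R} {u v w : V} {u' v' w' : V'}
  {n k : ℕ}

theorem updateRow_pow_eq_of_pow_eq (h : ∀ k < n, (P ^ k) u w = (P' ^ k) u' w')
    (hw : ∀ k < n, (P ^ k) w w = (P' ^ k) w' w') (hk : k < n) :
    (P.updateRow w 0 ^ k) u w = (P'.updateRow w' 0 ^ k) u' w' := by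
  induction k using Nat.strong_induction_on with
  | _ k ih =>
    have hsum : ∑ j ∈ Finset.range k, (P.updateRow w 0 ^ j) u w * (P ^ (k - j)) w w =
        ∑ j ∈ Finset.range k, (P'.updateRow w' 0 ^ j) u' w' * (P' ^ (k - j)) w' w' := by
      refine Finset.sum_congr rfl fun j hj => ?_
      have hj := Finset.mem_range.1 hj
      rw [ih j hj (hj.trans hk), hw (k - j) (by omega)]
    have hk' := h k hk
    rw [pow_apply_eq_updateRow_pow_add_sum P u w w, pow_apply_eq_updateRow_pow_add_sum P' u' w' w',
      hsum] at hk'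
    exact add_right_cancel hk'

theorem pow_eq_iff_updateRow_pow_eq (h : ∀ k < n, (P ^ k) u w = (P' ^ k) u' w')
    (hw : ∀ k < n, (P ^ k) w w = (P' ^ k) w' w') (hv : ∀ k < n, (P ^ k) w v = (P' ^ k) w' v')
    (hk : k < n) :
    (P ^ k) u v = (P' ^ k) u' v' ↔
      (P.updateRow w 0 ^ k) u v = (P'.updateRow w' 0 ^ k) u' v' := by
  have hsum : ∑ j ∈ Finset.range k, (P.updateRow w 0 ^ j) u w * (P ^ (k - j)) w v =
      ∑ j ∈ Finset.range k, (P'.updateRow w' 0 ^ j) u' w' * (P' ^ (k - j)) w' v' := by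
    refine Finset.sum_congr rfl fun j hj => ?_
    have hj := Finset.mem_range.1 hj
    rw [updateRow_pow_eq_of_pow_eq h hw (hj.trans hk), hv (k - j) (by omega)]
  rw [pow_apply_eq_updateRow_pow_add_sum P u v w, pow_apply_eq_updateRow_pow_add_sum P' u' v' w',
    hsum, add_left_inj]

end FirstPassage

section AvoidingPowers

open Matrix

variable {V R : Type*} [Fintype V] [DecidableEq V] [Semiring R] {G : SimpleGraph V} {u v w : V}

theorem reachable_of_pow_ne_zero {P : Matrix V V R} (hP : ∀ x y, P x y ≠ 0 → G.Adj x y) {k : ℕ}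
    (h : (P ^ k) u v ≠ 0) : G.Reachable u v := by
  induction k generalizing u with
  | zero =>
    obtain rfl : u = v := by_contra fun hne => h (by simp [hne])
    exact .refl _
  | succ k ih =>
    rw [pow_succ', mul_apply] at h
    obtain ⟨x, -, hx⟩ := Finset.exists_ne_zero_of_sum_ne_zero h
    exact (hP u x (left_ne_zero_of_mul hx)).reachable.trans (ih (right_ne_zero_of_mul hx))

theorem reachableAvoiding_of_updateRow_pow_ne_zero {P : Matrix V V R}
    (hP : ∀ x y, P x y ≠ 0 → G.Adj x y) (hv : w ≠ v) {k : ℕ}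
    (h : (P.updateRow w 0 ^ k) u v ≠ 0) : ReachableAvoiding G w u v := by
  induction k generalizing u with
  | zero =>
    obtain rfl : u = v := by_contra fun hne => h (by simp [hne])
    exact .refl hv
  | succ k ih =>
    rw [pow_succ', mul_apply] at h
    obtain ⟨x, -, hx⟩ := Finset.exists_ne_zero_of_sum_ne_zero h
    have hwu : w ≠ u := by
      rintro rfl
      simp at hx
    have hux := left_ne_zero_of_mul hx
    rw [updateRow_ne hwu.symm] at hux
    have hxv := ih (right_ne_zero_of_mul hx)
    exact .trans (.of_adj (hP u x hux) hwu hxv.ne_left) hxv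

theorem reachableAvoiding_iff_exists_pow_ne_zero [DecidableRel G.Adj] (hv : w ≠ v) :
    ReachableAvoiding G w u v ↔ ∃ k, ((G.adjMatrix ℕ).updateRow w 0 ^ k) u v ≠ 0 := by
  refine ⟨?_, fun ⟨k, hk⟩ => reachableAvoiding_of_updateRow_pow_ne_zero
    (fun x y h => by_contra fun hxy => h (by simp [hxy])) hv hk⟩
  rintro ⟨p, hp⟩
  induction p with
  | nil => exact ⟨0, by simp⟩
  | @cons a b c hab p ih =>
    rw [SimpleGraph.Walk.support_cons, List.mem_cons, not_or] at hp
    obtain ⟨k, hk⟩ := ih hv hp.2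
    refine ⟨k + 1, ?_⟩
    rw [pow_succ', mul_apply]
    refine fun h => mul_ne_zero ?_ hk (Finset.sum_eq_zero_iff.1 h b (Finset.mem_univ b))
    simp [updateRow_ne (Ne.symm hp.1), hab]

end AvoidingPowers

section RandomWalk

variable {V V' : Type} [Fintype V] [Fintype V'] {G : SimpleGraph V} {G' : SimpleGraph V'}

theorem adj_of_randomWalk_ne_zero {u v : V} (h : randomWalk G u v ≠ 0) : G.Adj u v := by
  classical
  rw [randomWalk, Matrix.diagonal_mul] at h
  by_contra hn
  simp [hn] at h

open Classical in
theorem degree_mul_randomWalk (u v : V) :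
    (G.degree u : ℝ) * randomWalk G u v = G.adjMatrix ℝ u v := by
  rw [randomWalk, Matrix.diagonal_mul, ← mul_assoc]
  by_cases h : G.Adj u v
  · have hu : (G.degree u : ℝ) ≠ 0 :=
      Nat.cast_ne_zero.2 ((G.degree_pos_iff_exists_adj u).2 ⟨v, h⟩).ne'
    rw [mul_inv_cancel₀ hu, one_mul]
  · simp [h]

open Classical in
theorem degree_mul_randomWalk_pow_comm (u v : V) (k : ℕ) :
    (G.degree u : ℝ) * (randomWalk G ^ k) u v = (G.degree v : ℝ) * (randomWalk G ^ k) v u := by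
  set D : Matrix V V ℝ := Matrix.diagonal fun v => (G.degree v : ℝ) with hD
  have hs : SemiconjBy D (randomWalk G) (randomWalk G).transpose := by
    ext u v
    rw [hD, Matrix.diagonal_mul, Matrix.mul_diagonal, Matrix.transpose_apply,
      degree_mul_randomWalk, mul_comm, degree_mul_randomWalk]
    simp [SimpleGraph.adjMatrix_apply, G.adj_comm]
  have h := congrFun (congrFun (hs.pow_right k).eq u) v
  rwa [hD, Matrix.diagonal_mul, Matrix.mul_diagonal, ← Matrix.transpose_pow,
    Matrix.transpose_apply, mul_comm _ (G.degree v : ℝ)] at h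

open Classical in
theorem randomWalk_pow_swap_eq {u v : V} {u' v' : V'} {k : ℕ} (hu : G.degree u = G'.degree u')
    (hv : G.degree v = G'.degree v') (hpos : G.degree v ≠ 0)
    (h : (randomWalk G ^ k) u v = (randomWalk G' ^ k) u' v') :
    (randomWalk G ^ k) v u = (randomWalk G' ^ k) v' u' := by
  have hmul := degree_mul_randomWalk_pow_comm (G := G) u v k
  rw [h, hu, degree_mul_randomWalk_pow_comm u' v', hv] at hmul
  exact (mul_left_cancel₀ (Nat.cast_ne_zero.2 (hv ▸ hpos)) hmul).symm

end RandomWalk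

/-! ### Multisets with equal images -/

section MapEq

variable {α α' β γ : Type*} {A : Multiset α} {A' : Multiset α'} {f : α → β} {f' : α' → β}

theorem map_eq_map_of_map_eq (h : A.map f = A'.map f') {g : α → γ} {g' : α' → γ}
    (hg : ∀ a ∈ A, ∀ a' ∈ A', f a = f' a' → g a = g' a') : A.map g = A'.map g' := by
  rw [← Multiset.rel_eq, Multiset.rel_map] at h ⊢
  exact h.mono hg

theorem bind_eq_bind_of_map_eq (h : A.map f = A'.map f') {g : α → Multiset γ}
    {g' : α' → Multiset γ} (hg : ∀ a ∈ A, ∀ a' ∈ A', f a = f' a' → g a = g' a') :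
    A.bind g = A'.bind g' :=
  congrArg Multiset.join (map_eq_map_of_map_eq h hg)

theorem map_filter_eq_of_map_eq (h : A.map f = A'.map f') {p : α → Prop} {p' : α' → Prop}
    [DecidablePred p] [DecidablePred p']
    (hp : ∀ a ∈ A, ∀ a' ∈ A', f a = f' a' → (p a ↔ p' a')) :
    (A.filter p).map f = (A'.filter p').map f' := by
  classical
  have hpair : A.map (fun a => (f a, p a)) = A'.map fun a => (f' a, p' a) :=
    map_eq_map_of_map_eq h fun a ha a' ha' e => Prod.ext e (propext (hp a ha a' ha' e))
  have hfilter := congrArg (fun m => (m.filter fun x => x.2).map Prod.fst) hpair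
  simpa only [Multiset.filter_map, Multiset.map_map, Function.comp_def] using hfilter

theorem exists_mem_of_map_eq (h : A.map f = A'.map f') {a : α} (ha : a ∈ A) :
    ∃ a' ∈ A', f a = f' a' := by
  obtain ⟨a', ha', e⟩ := Multiset.mem_map.1 (h ▸ Multiset.mem_map_of_mem f ha)
  exact ⟨a', ha', e.symm⟩

end MapEq

/-! ### Stable colorings -/

theorem eq_succ_of_antitone_of_card_le {α : Type*} [Finite α] {S : ℕ → Set α} (hS : Antitone S)
    (step : ∀ l, S l = S (l + 1) → S (l + 1) = S (l + 2)) {n : ℕ} (hn : Nat.card α ≤ n) :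
    S n = S (n + 1) := by
  have hmono : Monotone fun l => (S l)ᶜ.ncard := fun l m h =>
    Set.ncard_le_ncard (Set.compl_subset_compl.2 (hS h))
  have heq : ∀ l, (S l)ᶜ.ncard = (S (l + 1))ᶜ.ncard → S l = S (l + 1) := fun l h =>
    compl_injective (Set.eq_of_subset_of_ncard_le (Set.compl_subset_compl.2 (hS l.le_succ)) h.ge)
  have hstab : ∀ m, Nat.card α ≤ m → (S m)ᶜ.ncard = (S (Nat.card α))ᶜ.ncard := fun m =>
    Nat.stabilises_of_monotone hmono (fun l => Set.ncard_le_card _)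
      fun l h => congrArg (fun T : Set α => Tᶜ.ncard) (step l (heq l h))
  exact heq n ((hstab n hn).trans (hstab (n + 1) (hn.trans n.le_succ)).symm)

section Cardinality

open Cardinal

theorem mk_vec_le_continuum (d : ℕ) : #(Vec d) ≤ 𝔠 := by
  rw [Vec, ← power_def, mk_real, mk_fin]
  calc 𝔠 ^ (d : Cardinal) ≤ 𝔠 ^ ℵ₀ :=
        power_le_power_left continuum_ne_zero natCast_lt_aleph0.le
    _ = 𝔠 := continuum_power_aleph0

theorem mk_prod_le_continuum {α β : Type} (hα : #α ≤ 𝔠) (hβ : #β ≤ 𝔠) : #(α × β) ≤ 𝔠 := by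
  rw [mk_prod, lift_id, lift_id, ← continuum_mul_self]
  exact mul_le_mul' hα hβ

theorem mk_multiset_le_continuum {α : Type} (hα : #α ≤ 𝔠) : #(Multiset α) ≤ 𝔠 :=
  (mk_le_of_surjective (Quot.mk_surjective (r := List.isSetoid α))).trans
    ((mk_list_le_max α).trans (max_le aleph0_le_continuum hα))

theorem mk_initRep_le_continuum (dx de K : ℕ) : #(InitRep dx de K) ≤ 𝔠 :=
  mk_prod_le_continuum (mk_vec_le_continuum _) (mk_prod_le_continuum (mk_vec_le_continuum _)
    (mk_prod_le_continuum (mk_vec_le_continuum _) (mk_vec_le_continuum _)))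

theorem mk_pairRep_le_continuum {I : Type} (hI : #I ≤ 𝔠) (width : ℕ → ℕ) (l : ℕ) :
    #(PairRep I width l) ≤ 𝔠 := by
  cases l with
  | zero => exact hI
  | succ l => exact mk_vec_le_continuum _

theorem exists_injective_vec {α : Type} (h : #α ≤ 𝔠) : ∃ f : α → Vec 1, Function.Injective f := by
  have hvec : #(Vec 1) = 𝔠 := by rw [Vec, ← power_def, mk_real, mk_fin]; simp
  rw [← hvec] at h
  obtain ⟨f⟩ := h
  exact ⟨f, f.injective⟩

/-- All message and update functions are injective, so that the colors computed by the model are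
as fine as its neighborhoods permit. -/
def MessagePassing.IsInjective {I : Type} (M : MessagePassing I) : Prop :=
  (∀ l, Function.Injective2 (M.φ l)) ∧ ∀ l, Function.Injective2 (M.Φ l)

theorem MessagePassing.exists_isInjective {I : Type} (hI : #I ≤ 𝔠) (L : ℕ) :
    ∃ M : MessagePassing I, M.depth = L ∧ M.IsInjective := by
  have hφ : ∀ l, ∃ f : PairRep I (fun _ => 1) l × PairRep I (fun _ => 1) l → Vec 1,
      Function.Injective f := fun l => exists_injective_vec
    (mk_prod_le_continuum (mk_pairRep_le_continuum hI _ l) (mk_pairRep_le_continuum hI _ l))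
  have hΦ : ∀ l, ∃ f : PairRep I (fun _ => 1) l × Vec 1 → Vec 1, Function.Injective f := fun l =>
    exists_injective_vec (mk_prod_le_continuum (mk_pairRep_le_continuum hI _ l)
      (mk_vec_le_continuum 1))
  obtain ⟨agg, hagg⟩ := exists_injective_vec (mk_multiset_le_continuum (mk_vec_le_continuum 1))
  choose φ hφ using hφ
  choose Φ hΦ using hΦ
  exact ⟨⟨L, fun _ => 1, fun _ => 1, fun _ => 1, fun l x y => φ l (x, y), fun _ => agg,
    fun _ => hagg, fun l x y => Φ l (x, y)⟩, rfl, fun l _ _ _ _ h => Prod.mk.inj (hφ l h),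
    fun l _ _ _ _ h => Prod.mk.inj (hΦ l h)⟩

theorem StandardGNN.exists_isInjective (dx de K L : ℕ) :
    ∃ U : StandardGNN dx de K, U.depth = L ∧ U.IsInjective ∧ Function.Injective U.Ψ := by
  obtain ⟨M, rfl, hM⟩ := MessagePassing.exists_isInjective (mk_initRep_le_continuum dx de K) L
  obtain ⟨a, ha⟩ := exists_injective_vec (mk_multiset_le_continuum
    (mk_pairRep_le_continuum (mk_initRep_le_continuum dx de K) M.width M.depth))
  exact ⟨⟨M, 1, 1, a, ha, id⟩, rfl, hM, Function.injective_id⟩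

/- The first output coordinate tells the readout of a connected graph from the readout of a
disconnected one. -/
theorem CoSparsifiedGNN.exists_isInjective (dx de K L : ℕ) :
    ∃ U : CoSparsifiedGNN dx de K, U.depth = L ∧ U.IsInjective ∧ Function.Injective2 U.compOut ∧
      Function.Injective U.Ψ ∧ ∀ a b y, U.compOut a b ≠ U.Ψ y := by
  obtain ⟨M, rfl, hM⟩ := MessagePassing.exists_isInjective (mk_initRep_le_continuum dx de K) L
  obtain ⟨a, ha⟩ := exists_injective_vec (mk_multiset_le_continuum
    (mk_pairRep_le_continuum (mk_initRep_le_continuum dx de K) M.width M.depth))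
  obtain ⟨b, hb⟩ := exists_injective_vec (mk_multiset_le_continuum (mk_vec_le_continuum 2))
  obtain ⟨f, hf⟩ := exists_injective_vec
    (mk_prod_le_continuum (mk_vec_le_continuum 1) (mk_vec_le_continuum 1))
  have hvec : ∀ {y y' : Vec 1} {i : ℝ}, (![i, y 0] : Vec 2) = ![i, y' 0] → y = y' := fun h =>
    funext fun j => by simpa [Subsingleton.elim j 0] using congrFun h 1
  exact ⟨⟨M, 1, 1, 2, a, ha, fun x y => ![0, f (x, y) 0], b, hb, fun y => ![1, y 0]⟩, rfl, hM,
    fun _ _ _ _ h => Prod.mk.inj (hf (hvec h)), fun _ _ h => hvec h,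
    fun _ _ _ h => zero_ne_one (congrFun h 0)⟩

end Cardinality

namespace MessagePassing

variable {I V V' : Type} {M : MessagePassing I} {l : ℕ}

theorem IsInjective.update_eq_iff (hM : M.IsInjective) {A : Multiset V} {A' : Multiset V'}
    {x x' : PairRep I M.width l} {f g : V → PairRep I M.width l}
    {f' g' : V' → PairRep I M.width l} :
    M.Φ l x (M.agg l (A.map fun t => M.φ l (f t) (g t))) =
        M.Φ l x' (M.agg l (A'.map fun t => M.φ l (f' t) (g' t))) ↔
      x = x' ∧ A.map (fun t => (f t, g t)) = A'.map fun t => (f' t, g' t) := by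
  rw [(hM.2 l).eq_iff, (M.agg_injective l).eq_iff,
    ← (Multiset.map_injective (hM.1 l).uncurry).eq_iff, Multiset.map_map, Multiset.map_map]
  rfl

variable [Fintype V] [Fintype V'] {h₀ : V → V → I} {h₀' : V' → V' → I} {n : ℕ} {u v : V}
  {u' v' : V'}

theorem IsInjective.stdRep_succ_eq_iff (hM : M.IsInjective) :
    M.stdRep h₀ (l + 1) u v = M.stdRep h₀' (l + 1) u' v' ↔
      M.stdRep h₀ l u v = M.stdRep h₀' l u' v' ∧
      ((Finset.univ : Finset V).val.map fun t => (M.stdRep h₀ l u t, M.stdRep h₀ l t v)) =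
        (Finset.univ : Finset V').val.map fun t => (M.stdRep h₀' l u' t, M.stdRep h₀' l t v') :=
  hM.update_eq_iff

theorem IsInjective.init_eq_of_stdRep_eq (hM : M.IsInjective)
    (h : M.stdRep h₀ l u v = M.stdRep h₀' l u' v') : h₀ u v = h₀' u' v' := by
  induction l with
  | zero => exact h
  | succ l ih => exact ih (hM.stdRep_succ_eq_iff.1 h).1

theorem IsInjective.stdRep_stable (hM : M.IsInjective)
    (hn : Nat.card ((V × V) × (V' × V')) ≤ n) (h : M.stdRep h₀ n u v = M.stdRep h₀' n u' v') :
    ((Finset.univ : Finset V).val.map fun t => (M.stdRep h₀ n u t, M.stdRep h₀ n t v)) =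
      (Finset.univ : Finset V').val.map fun t => (M.stdRep h₀' n u' t, M.stdRep h₀' n t v') := by
  set S : ℕ → Set ((V × V) × (V' × V')) := fun l =>
    {p | M.stdRep h₀ l p.1.1 p.1.2 = M.stdRep h₀' l p.2.1 p.2.2}
  have hS : Antitone S := antitone_nat_of_succ_le fun l p hp => (hM.stdRep_succ_eq_iff.1 hp).1
  have hstep : ∀ l, S l = S (l + 1) → S (l + 1) = S (l + 2) := by
    refine fun l hl => (hS l.succ.le_succ).antisymm' fun ⟨(u, v), u', v'⟩ hp => ?_
    refine hM.stdRep_succ_eq_iff.2 ⟨hp, ?_⟩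
    refine map_eq_map_of_map_eq (hM.stdRep_succ_eq_iff.1 hp).2 fun t _ t' _ e => ?_
    have hle : ∀ p ∈ S l, p ∈ S (l + 1) := fun _ hp => hl ▸ hp
    obtain ⟨e₁, e₂⟩ := Prod.mk.inj e
    exact Prod.ext (hle ((u, t), u', t') e₁) (hle ((t, v), t', v') e₂)
  have hlast : ((u, v), u', v') ∈ S (n + 1) := eq_succ_of_antitone_of_card_le hS hstep hn ▸ h
  exact (hM.stdRep_succ_eq_iff.1 hlast).2

variable {G : SimpleGraph V} {G' : SimpleGraph V'}

theorem spRep_succ_of_reachable (h : G.Reachable u v) (l : ℕ) :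
    M.spRep G h₀ (l + 1) u v = M.Φ l (M.spRep G h₀ l u v)
      (M.agg l ((spNbr G u v).val.map fun t =>
        M.φ l (M.spRep G h₀ l u t) (M.spRep G h₀ l t v))) :=
  if_pos h

theorem IsInjective.spRep_succ_eq_iff (hM : M.IsInjective) (hr : G.Reachable u v)
    (hr' : G'.Reachable u' v') :
    M.spRep G h₀ (l + 1) u v = M.spRep G' h₀' (l + 1) u' v' ↔
      M.spRep G h₀ l u v = M.spRep G' h₀' l u' v' ∧
      ((spNbr G u v).val.map fun t => (M.spRep G h₀ l u t, M.spRep G h₀ l t v)) =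
        (spNbr G' u' v').val.map fun t => (M.spRep G' h₀' l u' t, M.spRep G' h₀' l t v') := by
  rw [spRep_succ_of_reachable hr, spRep_succ_of_reachable hr']
  exact hM.update_eq_iff

theorem IsInjective.init_eq_of_spRep_eq (hM : M.IsInjective) (hr : G.Reachable u v)
    (hr' : G'.Reachable u' v') (h : M.spRep G h₀ l u v = M.spRep G' h₀' l u' v') :
    h₀ u v = h₀' u' v' := by
  induction l with
  | zero => exact h
  | succ l ih => exact ih ((hM.spRep_succ_eq_iff hr hr').1 h).1

theorem IsInjective.spRep_stable (hM : M.IsInjective)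
    (hn : Nat.card ((V × V) × (V' × V')) ≤ n) (hr : G.Reachable u v) (hr' : G'.Reachable u' v')
    (h : M.spRep G h₀ n u v = M.spRep G' h₀' n u' v') :
    ((spNbr G u v).val.map fun t => (M.spRep G h₀ n u t, M.spRep G h₀ n t v)) =
      (spNbr G' u' v').val.map fun t => (M.spRep G' h₀' n u' t, M.spRep G' h₀' n t v') := by
  set S : ℕ → Set ((V × V) × (V' × V')) := fun l =>
    {p | G.Reachable p.1.1 p.1.2 ∧ G'.Reachable p.2.1 p.2.2 ∧
      M.spRep G h₀ l p.1.1 p.1.2 = M.spRep G' h₀' l p.2.1 p.2.2}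
  have hS : Antitone S := antitone_nat_of_succ_le fun l p ⟨hp, hp', e⟩ =>
    ⟨hp, hp', ((hM.spRep_succ_eq_iff hp hp').1 e).1⟩
  have hstep : ∀ l, S l = S (l + 1) → S (l + 1) = S (l + 2) := by
    refine fun l hl => (hS l.succ.le_succ).antisymm' fun ⟨(u, v), u', v'⟩ ⟨hp, hp', hpe⟩ => ?_
    refine ⟨hp, hp', (hM.spRep_succ_eq_iff hp hp').2 ⟨hpe, ?_⟩⟩
    refine map_eq_map_of_map_eq ((hM.spRep_succ_eq_iff hp hp').1 hpe).2 fun t ht t' ht' e => ?_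
    have ht : SpInteraction G u t v := mem_spNbr.1 ht
    have ht' : SpInteraction G' u' t' v' := mem_spNbr.1 ht'
    have hle : ∀ p ∈ S l, p ∈ S (l + 1) := fun _ hp => hl ▸ hp
    obtain ⟨e₁, e₂⟩ := Prod.mk.inj e
    exact Prod.ext
      (hle ((u, t), u', t') ⟨ht.reachable_left, ht'.reachable_left, e₁⟩).2.2
      (hle ((t, v), t', v') ⟨ht.reachable_right, ht'.reachable_right, e₂⟩).2.2
  have hlast : ((u, v), u', v') ∈ S (n + 1) :=
    eq_succ_of_antitone_of_card_le hS hstep hn ▸ ⟨hr, hr', h⟩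
  exact ((hM.spRep_succ_eq_iff hr hr').1 hlast.2.2).2

end MessagePassing

/-- Equality of the colors `c` and `c'` of pairs is stable under 2-FWL refinement, and equal colors
agree on whether the pair is diagonal and whether it is an edge. -/
structure IsFWLStable {V V' X : Type*} [Fintype V] [Fintype V'] (G : SimpleGraph V)
    (G' : SimpleGraph V') (c : V → V → X) (c' : V' → V' → X) : Prop where
  diag : ∀ {u v u' v'}, c u v = c' u' v' → (u = v ↔ u' = v')
  adj : ∀ {u v u' v'}, c u v = c' u' v' → (G.Adj u v ↔ G'.Adj u' v')
  stable : ∀ {u v u' v'}, c u v = c' u' v' →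
    ((Finset.univ : Finset V).val.map fun t => (c u t, c t v)) =
      (Finset.univ : Finset V').val.map fun t => (c' u' t, c' t v')

namespace IsFWLStable

section General

variable {V V' X : Type*} [Fintype V] [Fintype V'] {G : SimpleGraph V} {G' : SimpleGraph V'}
  {c : V → V → X} {c' : V' → V' → X} {u v w : V} {u' v' w' : V'}

theorem symm (h : IsFWLStable G G' c c') : IsFWLStable G' G c' c where
  diag e := (h.diag e.symm).symm
  adj e := (h.adj e.symm).symm
  stable e := (h.stable e.symm).symm

theorem exists_mid (h : IsFWLStable G G' c c') (e : c u v = c' u' v') (t : V) :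
    ∃ t', c u t = c' u' t' ∧ c t v = c' t' v' := by
  obtain ⟨t', -, et⟩ := exists_mem_of_map_eq (h.stable e) (Finset.mem_univ_val t)
  exact ⟨t', Prod.mk.inj et⟩

theorem right (h : IsFWLStable G G' c c') (e : c u v = c' u' v') : c v v = c' v' v' := by
  obtain ⟨t', -, et⟩ := h.exists_mid e v
  obtain rfl := (h.diag et).1 rfl
  exact et

theorem reachable (h : IsFWLStable G G' c c') (e : c u v = c' u' v') (hr : G.Reachable u v) :
    G'.Reachable u' v' := by
  obtain ⟨p⟩ := hr
  induction p generalizing u' v' with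
  | nil => exact (h.diag e).1 rfl ▸ .refl _
  | @cons a b d hab _ ih =>
    obtain ⟨b', e₁, e₂⟩ := h.exists_mid e b
    exact ((h.adj e₁).1 hab).reachable.trans (ih e₂)

theorem reachable_iff (h : IsFWLStable G G' c c') (e : c u v = c' u' v') :
    G.Reachable u v ↔ G'.Reachable u' v' :=
  ⟨h.reachable e, h.symm.reachable e.symm⟩

open Classical in
theorem adjMatrix_pow_eq (h : IsFWLStable G G' c c') (e : c u v = c' u' v') (k : ℕ) :
    (G.adjMatrix ℕ ^ k) u v = (G'.adjMatrix ℕ ^ k) u' v' := by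
  induction k generalizing u v u' v' with
  | zero => simp [Matrix.one_apply, h.diag e]
  | succ k ih =>
    rw [pow_succ, pow_succ, Matrix.mul_apply, Matrix.mul_apply]
    refine congrArg Multiset.sum (map_eq_map_of_map_eq (h.stable e) fun t _ t' _ et => ?_)
    obtain ⟨e₁, e₂⟩ := Prod.mk.inj et
    simp only [ih e₁, SimpleGraph.adjMatrix_apply, h.adj e₂]

theorem reachableAvoiding_iff (h : IsFWLStable G G' c c') (e : c u v = c' u' v')
    (e₁ : c u w = c' u' w') (e₂ : c w v = c' w' v') :
    ReachableAvoiding G w u v ↔ ReachableAvoiding G' w' u' v' := by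
  classical
  by_cases hw : w = v
  · have hw' := (h.diag e₂).1 hw
    exact ⟨fun h => absurd hw h.ne_right, fun h => absurd hw' h.ne_right⟩
  have hw' := mt (h.diag e₂).2 hw
  rw [reachableAvoiding_iff_exists_pow_ne_zero hw, reachableAvoiding_iff_exists_pow_ne_zero hw']
  refine exists_congr fun k => ?_
  rw [(pow_eq_iff_updateRow_pow_eq (fun k _ => h.adjMatrix_pow_eq e₁ k)
    (fun k _ => h.adjMatrix_pow_eq (h.right e₁) k) (fun k _ => h.adjMatrix_pow_eq e₂ k)
    k.lt_succ_self).1 (h.adjMatrix_pow_eq e k)]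

theorem unseparated (h : IsFWLStable G G' c c') (e : c u v = c' u' v')
    (huv : Unseparated G u v) : Unseparated G' u' v' := by
  refine ⟨mt (h.diag e).2 huv.ne, h.reachable e huv.reachable, fun s' hs hs' => ?_⟩
  obtain ⟨s, e₁, e₂⟩ := h.symm.exists_mid e.symm s'
  refine (h.reachableAvoiding_iff e e₁.symm e₂.symm).1 (huv.avoiding s ?_ ?_)
  · exact fun hsu => hs ((h.diag e₁.symm).1 hsu.symm).symm
  · exact mt (h.diag e₂.symm).1 hs'

theorem unseparated_iff (h : IsFWLStable G G' c c') (e : c u v = c' u' v') :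
    Unseparated G u v ↔ Unseparated G' u' v' :=
  ⟨h.unseparated e, h.symm.unseparated e.symm⟩

end General

variable {V V' : Type} {X : Type*} [Fintype V] [Fintype V'] {G : SimpleGraph V}
  {G' : SimpleGraph V'} {c : V → V → X} {c' : V' → V' → X} {t u v : V} {t' u' v' : V'}

theorem spInteraction_iff (h : IsFWLStable G G' c c') (e : c u v = c' u' v')
    (e₁ : c u t = c' u' t') (e₂ : c t v = c' t' v') :
    SpInteraction G u t v ↔ SpInteraction G' u' t' v' := by
  rw [_root_.spInteraction_iff, _root_.spInteraction_iff, h.reachable_iff e, h.reachable_iff e₁,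
    h.diag e, h.unseparated_iff e, h.unseparated_iff e₁, h.unseparated_iff e₂, h.diag e₂,
    eq_comm (a := t), h.diag e₁, eq_comm (a := u') (b := t')]
  simp only [ne_eq, h.diag e]

theorem spNbr_map_eq (h : IsFWLStable G G' c c') (e : c u v = c' u' v') :
    (spNbr G u v).val.map (fun t => (c u t, c t v)) =
      (spNbr G' u' v').val.map fun t => (c' u' t, c' t v') := by
  classical
  refine map_filter_eq_of_map_eq (h.stable e) fun t _ t' _ et => ?_
  obtain ⟨e₁, e₂⟩ := Prod.mk.inj et
  exact h.spInteraction_iff e e₁ e₂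

theorem spRep_eq (h : IsFWLStable G G' c c') {I : Type} (M : MessagePassing I) {h₀ : V → V → I}
    {h₀' : V' → V' → I} (h0 : ∀ {u v u' v'}, c u v = c' u' v' → h₀ u v = h₀' u' v') (l : ℕ)
    (e : c u v = c' u' v') : M.spRep G h₀ l u v = M.spRep G' h₀' l u' v' := by
  induction l generalizing u v u' v' with
  | zero => exact h0 e
  | succ l ih =>
    by_cases hr : G.Reachable u v
    · have hr' := h.reachable e hr
      rw [MessagePassing.spRep_succ_of_reachable hr, MessagePassing.spRep_succ_of_reachable hr',
        ih e]
      refine congrArg (M.Φ l _) (congrArg (M.agg l) ?_)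
      refine map_eq_map_of_map_eq (h.spNbr_map_eq e) fun t _ t' _ et => ?_
      obtain ⟨e₁, e₂⟩ := Prod.mk.inj et
      rw [ih e₁, ih e₂]
    · exact (if_neg hr).trans (if_neg (mt (h.reachable_iff e).2 hr)).symm

end IsFWLStable

section Fibers

variable {V V' C C' γ : Type*} [Fintype V] [Fintype V']

open Classical in
theorem card_filter_comp_eq_mul (f : V → C) (z : C → γ × ℕ)
    (hz : ∀ u, (z (f u)).2 = (Finset.univ.filter (f · = f u)).card) (x : γ × ℕ) :
    (Finset.univ.filter fun u => z (f u) = x).card =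
      x.2 * ((Finset.univ.image f).filter fun c => z c = x).card := by
  rw [Finset.card_filter, Finset.sum_comp (fun c => if z c = x then 1 else 0) f, Finset.card_filter,
    Finset.mul_sum]
  refine Finset.sum_congr rfl fun c hc => ?_
  obtain ⟨u, -, rfl⟩ := Finset.mem_image.1 hc
  by_cases hx : z (f u) = x
  · rw [if_pos hx, ← hx, hz, smul_eq_mul]
  · simp [hx]

open Classical in
theorem map_image_eq_of_map_eq {f : V → C} {f' : V' → C'} {z : C → γ} {z' : C' → γ}
    (h : ((Finset.univ : Finset V).val.map fun u =>
        (z (f u), (Finset.univ.filter (f · = f u)).card)) =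
      (Finset.univ : Finset V').val.map fun u =>
        (z' (f' u), (Finset.univ.filter (f' · = f' u)).card)) :
    (Finset.univ.image f).val.map z = (Finset.univ.image f').val.map z' := by
  suffices hs : (Finset.univ.image f).val.map
      (fun c => (z c, (Finset.univ.filter (f · = c)).card)) =
      (Finset.univ.image f').val.map fun c => (z' c, (Finset.univ.filter (f' · = c)).card) from
    map_eq_map_of_map_eq hs fun _ _ _ _ e => congrArg Prod.fst e
  ext ⟨y, n⟩
  rcases n.eq_zero_or_pos with rfl | hn
  · rw [Multiset.count_eq_zero_of_notMem, Multiset.count_eq_zero_of_notMem] <;>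
      simp +contextual [Finset.filter_eq_empty_iff]
  have hcount := congrArg (Multiset.count (y, n)) h
  simp only [Multiset.count_map, eq_comm (a := (y, n))] at hcount ⊢
  have hmul := card_filter_comp_eq_mul f
    (fun c => (z c, (Finset.univ.filter (f · = c)).card)) (fun _ => rfl) (y, n)
  have hmul' := card_filter_comp_eq_mul f'
    (fun c => (z' c, (Finset.univ.filter (f' · = c)).card)) (fun _ => rfl) (y, n)
  exact Nat.eq_of_mul_eq_mul_left hn (hmul.symm.trans (hcount.trans hmul'))

end Fibers

section Decomposition

variable {α β : Type*}

theorem val_eq_bind_of_mem_iff {s : Finset β} {I : Finset α} {f : α → Finset β}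
    (hmem : ∀ b, b ∈ s ↔ ∃ a ∈ I, b ∈ f a)
    (hinj : ∀ a ∈ I, ∀ a' ∈ I, ∀ b ∈ f a, b ∈ f a' → a = a') :
    s.val = I.val.bind fun a => (f a).val := by
  have hdisj : (I : Set α).PairwiseDisjoint f := fun a ha a' ha' hne =>
    Finset.disjoint_left.2 fun b hb hb' => hne (hinj a ha a' ha' b hb hb')
  rw [← Finset.disjiUnion_val _ _ hdisj, show s = I.disjiUnion f hdisj by ext b; simp [hmem]]

theorem val_eq_add_of_mem_iff {s a b : Finset α} (hmem : ∀ x, x ∈ s ↔ x ∈ a ∨ x ∈ b)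
    (hdisj : ∀ x ∈ a, x ∉ b) : s.val = a.val + b.val := by
  rw [← Finset.disjUnion_val a b (Finset.disjoint_left.2 hdisj)]
  congr 1
  ext x
  simp [hmem]

theorem val_eq_add_bind_of_mem_iff {s r : Finset β} {I : Finset α} {f : α → Finset β}
    (hmem : ∀ b, b ∈ s ↔ b ∈ r ∨ ∃ a ∈ I, b ∈ f a) (hdisj : ∀ b ∈ r, ∀ a ∈ I, b ∉ f a)
    (hinj : ∀ a ∈ I, ∀ a' ∈ I, ∀ b ∈ f a, b ∈ f a' → a = a') :
    s.val = r.val + I.val.bind fun a => (f a).val := by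
  classical
  rw [← val_eq_bind_of_mem_iff (s := I.biUnion f) (fun _ => Finset.mem_biUnion) hinj]
  exact val_eq_add_of_mem_iff (by simpa only [Finset.mem_biUnion]) (by simpa using hdisj)

theorem offDiag_val_eq_bind [DecidableEq α] (s : Finset α) :
    s.offDiag.val = s.val.bind fun a => (s.filter (a ≠ ·)).val.map (Prod.mk a) :=
  val_eq_bind_of_mem_iff (f := fun a => (s.filter (a ≠ ·)).map (.sectR a α)) (by aesop) (by aesop)

end Decomposition

section Diagonal

variable {V V' X : Type*} [Fintype V] [Fintype V'] {c : V → V → X} {c' : V' → V' → X}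

open Classical in
theorem filter_diag_map_eq (c : V → V → X) :
    ((Finset.univ : Finset (V × V)).val.filter fun p => p.1 = p.2).map (fun p => c p.1 p.2) =
      (Finset.univ : Finset V).val.map fun u => c u u := by
  have hdiag : (Finset.univ.filter fun p : V × V => p.1 = p.2) = Finset.univ.diag := by ext; simp
  rw [← Finset.filter_val, hdiag, Finset.diag, Finset.map_val, Multiset.map_map]
  rfl

theorem diag_map_eq_of_pairs_map_eq (hdiag : ∀ {u v u' v'}, c u v = c' u' v' → (u = v ↔ u' = v'))
    (h : ((Finset.univ : Finset (V × V)).val.map fun p => c p.1 p.2) =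
      (Finset.univ : Finset (V' × V')).val.map fun p => c' p.1 p.2) :
    ((Finset.univ : Finset V).val.map fun u => c u u) =
      (Finset.univ : Finset V').val.map fun u => c' u u := by
  classical
  rw [← filter_diag_map_eq c, ← filter_diag_map_eq c']
  exact map_filter_eq_of_map_eq h fun _ _ _ _ => hdiag

end Diagonal

open Classical in
/-- The vertices of the connected component of `u`. -/
noncomputable def compVerts {V : Type*} [Fintype V] (G : SimpleGraph V) (u : V) : Finset V :=
  Finset.univ.filter (G.Reachable u)

section Component

variable {V : Type*} [Fintype V] {G : SimpleGraph V} {u v : V}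

theorem mem_compVerts : v ∈ compVerts G u ↔ G.Reachable u v := by simp [compVerts]

theorem compVerts_eq_of_reachable (h : G.Reachable u v) : compVerts G u = compVerts G v := by
  ext t
  rw [mem_compVerts, mem_compVerts]
  exact ⟨h.symm.trans, h.trans⟩

open Classical in
theorem filter_mem_supp_eq_compVerts :
    Finset.univ.filter (· ∈ (G.connectedComponentMk u).supp) = compVerts G u := by
  ext t
  simp [compVerts, SimpleGraph.reachable_comm]

open Classical in
theorem filter_pairs_eq_offDiag_compVerts :
    (Finset.univ.filter fun p : V × V => p.1 ∈ (G.connectedComponentMk u).supp ∧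
      p.2 ∈ (G.connectedComponentMk u).supp ∧ p.1 ≠ p.2) = (compVerts G u).offDiag := by
  ext p
  simp [mem_compVerts, SimpleGraph.reachable_comm]

end Component

namespace IsFWLStable

section General

variable {V V' X : Type*} [Fintype V] [Fintype V'] {G : SimpleGraph V} {G' : SimpleGraph V'}
  {c : V → V → X} {c' : V' → V' → X} {u : V} {u' : V'}

theorem compVerts_map_eq (h : IsFWLStable G G' c c') (e : c u u = c' u' u') :
    (compVerts G u).val.map (fun t => (c u t, c t u)) =
      (compVerts G' u').val.map fun t => (c' u' t, c' t u') := by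
  classical
  refine map_filter_eq_of_map_eq (h.stable e) fun t _ t' _ et => ?_
  exact h.reachable_iff (Prod.mk.inj et).1

theorem compVerts_offDiag_map_eq (h : IsFWLStable G G' c c') (e : c u u = c' u' u') :
    (compVerts G u).offDiag.val.map (fun p => c p.1 p.2) =
      (compVerts G' u').offDiag.val.map fun p => c' p.1 p.2 := by
  classical
  rw [offDiag_val_eq_bind, offDiag_val_eq_bind, Multiset.map_bind, Multiset.map_bind]
  refine bind_eq_bind_of_map_eq (h.compVerts_map_eq e) fun s hs s' hs' es => ?_
  rw [compVerts_eq_of_reachable (mem_compVerts.1 hs),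
    compVerts_eq_of_reachable (mem_compVerts.1 hs'), Multiset.map_map, Multiset.map_map]
  refine map_eq_map_of_map_eq (map_filter_eq_of_map_eq
    (h.compVerts_map_eq (h.right (Prod.mk.inj es).1)) fun t _ t' _ et => ?_)
    fun t _ t' _ et => (Prod.mk.inj et).1
  exact (h.diag (Prod.mk.inj et).1).not

theorem connected (h : IsFWLStable G G' c c')
    (hD : ((Finset.univ : Finset V).val.map fun u => c u u) =
      (Finset.univ : Finset V').val.map fun u => c' u u) (hG : G.Connected) : G'.Connected := by
  obtain ⟨u⟩ := hG.nonempty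
  obtain ⟨u', -, e⟩ := exists_mem_of_map_eq hD (Finset.mem_univ_val u)
  refine G'.connected_iff_exists_forall_reachable.2 ⟨u', fun t' => ?_⟩
  obtain ⟨t, et, -⟩ := h.symm.exists_mid e.symm t'
  exact h.reachable et.symm (hG.preconnected u t)

end General

variable {dx de K : ℕ} {X : Type*} {G H : AttrGraph dx de} {c : G.V → G.V → X} {c' : H.V → H.V → X}

theorem compRep_eq (h : IsFWLStable G.graph H.graph c c')
    (h0 : ∀ {u v u' v'}, c u v = c' u' v' → initRep K G u v = initRep K H u' v')
    (M : CoSparsifiedGNN dx de K) {u : G.V} {u' : H.V} (e : c u u = c' u' u') :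
    M.compRep G (G.graph.connectedComponentMk u) =
      M.compRep H (H.graph.connectedComponentMk u') := by
  classical
  unfold CoSparsifiedGNN.compRep
  rw [filter_mem_supp_eq_compVerts, filter_mem_supp_eq_compVerts,
    filter_pairs_eq_offDiag_compVerts, filter_pairs_eq_offDiag_compVerts]
  congr 2
  · exact map_eq_map_of_map_eq (h.compVerts_map_eq e) fun t _ t' _ et =>
      h.spRep_eq _ h0 _ (h.right (Prod.mk.inj et).1)
  · exact map_eq_map_of_map_eq (h.compVerts_offDiag_map_eq e) fun p _ p' _ ep =>
      h.spRep_eq _ h0 _ ep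

theorem out_eq (h : IsFWLStable G.graph H.graph c c')
    (h0 : ∀ {u v u' v'}, c u v = c' u' v' → initRep K G u v = initRep K H u' v')
    (hD : ((Finset.univ : Finset G.V).val.map fun u => c u u) =
      (Finset.univ : Finset H.V).val.map fun u => c' u u)
    (M : CoSparsifiedGNN dx de K) : M.out G = M.out H := by
  classical
  by_cases hG : G.graph.Connected
  · have hH : H.graph.Connected := h.connected hD hG
    rw [CoSparsifiedGNN.out, CoSparsifiedGNN.out, dif_pos hG, dif_pos hH]
    obtain ⟨u', -, e⟩ := exists_mem_of_map_eq hD (Finset.mem_univ_val hG.nonempty.some)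
    rw [h.compRep_eq h0 M e]
    exact congrArg _ (SimpleGraph.ConnectedComponent.sound (hH.preconnected _ _))
  · have hH : ¬ H.graph.Connected := mt (h.symm.connected hD.symm) hG
    rw [CoSparsifiedGNN.out, CoSparsifiedGNN.out, dif_neg hG, dif_neg hH]
    refine congrArg M.Ψ (congrArg M.compAgg (map_image_eq_of_map_eq ?_))
    refine map_eq_map_of_map_eq hD fun u _ u' _ e => Prod.ext (h.compRep_eq h0 M e) ?_
    have hcard : (compVerts G.graph u).card = (compVerts H.graph u').card := by
      simpa only [Multiset.card_map, Finset.card_val] using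
        congrArg Multiset.card (h.compVerts_map_eq e)
    simpa [compVerts, SimpleGraph.reachable_comm] using hcard

end IsFWLStable

theorem natCard_pairs_le {V V' : Type*} [Fintype V] [Fintype V'] {N : ℕ}
    (hV : Fintype.card V ≤ N) (hV' : Fintype.card V' ≤ N) :
    Nat.card ((V × V) × (V' × V')) ≤ N * N * (N * N) := by
  simp only [Nat.card_eq_fintype_card, Fintype.card_prod]
  gcongr

theorem exists_standardGNN_dominating {dx de K N : ℕ} {𝒢 : Set (AttrGraph dx de)}
    (hN : ∀ G ∈ 𝒢, Fintype.card G.V ≤ N) (hinit : ConsistentInit K 𝒢) :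
    ∃ U : StandardGNN dx de K, ∀ G ∈ 𝒢, ∀ H ∈ 𝒢, U.out G = U.out H →
      ∀ M : CoSparsifiedGNN dx de K, M.out G = M.out H := by
  obtain ⟨U, hL, hU, hΨ⟩ := StandardGNN.exists_isInjective dx de K (N * N * (N * N))
  refine ⟨U, fun G hG H hH hout M => ?_⟩
  have hcard : Nat.card ((G.V × G.V) × (H.V × H.V)) ≤ U.depth :=
    hL ▸ natCard_pairs_le (hN G hG) (hN H hH)
  have h0 : ∀ {u v : G.V} {u' v' : H.V}, U.stdRep (initRep K G) U.depth u v =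
      U.stdRep (initRep K H) U.depth u' v' → initRep K G u v = initRep K H u' v' :=
    hU.init_eq_of_stdRep_eq
  have hB : IsFWLStable G.graph H.graph (U.stdRep (initRep K G) U.depth)
      (U.stdRep (initRep K H) U.depth) :=
    { diag := fun e => (hinit G hG H hH _ _ _ _ (h0 e)).1
      adj := fun e => (hinit G hG H hH _ _ _ _ (h0 e)).2
      stable := hU.stdRep_stable hcard }
  exact hB.out_eq h0 (diag_map_eq_of_pairs_map_eq hB.diag (U.readAgg_injective (hΨ hout))) M

/-! ### Chains of cut vertices -/

section Chain

open Classical in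
/-- The colors of the consecutive pairs along the sequence of cut vertices from `u` to `v`, where
each vertex is not separated from the next. -/
noncomputable def colorChain {V X : Type*} [Finite V] (G : SimpleGraph V) (c : V → V → X)
    (u v : V) : List X :=
  if h : ∃ w, Unseparated G u w ∧ Between G u w v then
    c u h.choose :: colorChain G c h.choose v
  else []
termination_by (cutVerts G u v).ncard
decreasing_by
  exact Set.ncard_lt_ncard (h.choose_spec.2.cutVerts_ssubset_right h.choose_spec.1.ne.symm)
    (Set.toFinite _)

variable {V X : Type*} [Finite V] {G : SimpleGraph V} {c : V → V → X} {u v w : V}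

theorem colorChain_self : colorChain G c u u = [] := by
  rw [colorChain, dif_neg]
  rintro ⟨w, hw, hb⟩
  exact hb.2 (.refl hw.ne.symm)

theorem colorChain_cons (hw : Unseparated G u w) (hb : Between G u w v) :
    colorChain G c u v = c u w :: colorChain G c w v := by
  have h : ∃ w, Unseparated G u w ∧ Between G u w v := ⟨w, hw, hb⟩
  rw [colorChain, dif_pos h, h.choose_spec.1.eq_of_between hw h.choose_spec.2 hb]

theorem colorChain_of_unseparated (h : Unseparated G u v) : colorChain G c u v = [c u v] := by
  rw [colorChain_cons h (.right h.reachable), colorChain_self]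

theorem exists_colorChain_eq_cons (h : G.Reachable u v) (hne : u ≠ v) :
    ∃ w, Unseparated G u w ∧ Between G u w v ∧
      colorChain G c u v = c u w :: colorChain G c w v := by
  obtain ⟨w, hw, hb⟩ := exists_unseparated_between h hne
  exact ⟨w, hw, hb, colorChain_cons hw hb⟩

theorem colorChain_eq_nil_iff (h : G.Reachable u v) : colorChain G c u v = [] ↔ u = v := by
  refine ⟨fun e => by_contra fun hne => ?_, ?_⟩
  · obtain ⟨w, -, -, e'⟩ := exists_colorChain_eq_cons (c := c) h hne
    exact List.cons_ne_nil _ _ (e' ▸ e)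
  · rintro rfl
    exact colorChain_self

theorem exists_unseparated_of_colorChain_eq_cons (h : G.Reachable u v) {a : X} {l : List X}
    (e : colorChain G c u v = a :: l) :
    ∃ w, Unseparated G u w ∧ Between G u w v ∧ c u w = a ∧ colorChain G c w v = l := by
  have hne : u ≠ v := fun huv => List.cons_ne_nil _ _ (e ▸ (colorChain_eq_nil_iff h).2 huv)
  obtain ⟨w, hw, hb, e'⟩ := exists_colorChain_eq_cons (c := c) h hne
  exact ⟨w, hw, hb, List.cons.inj (e' ▸ e)⟩

theorem colorChain_append (h : Between G u w v) :
    colorChain G c u v = colorChain G c u w ++ colorChain G c w v := by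
  refine cutVerts_induction (motive := fun u => Between G u w v →
    colorChain G c u v = colorChain G c u w ++ colorChain G c w v) h.reachable_left ?_ ?_ h
  · intro _
    rw [colorChain_self, List.nil_append]
  · intro u x hx hb ih h
    rw [colorChain_cons hx hb, colorChain_cons hx (hb.trans h), ih (hb.right_of_between h),
      List.cons_append]

theorem colorChain_swap {τ : X → X} (hτ : ∀ u v, c v u = τ (c u v)) (h : G.Reachable u v) :
    colorChain G c v u = (colorChain G c u v).reverse.map τ := by
  refine cutVerts_induction
    (motive := fun u => colorChain G c v u = (colorChain G c u v).reverse.map τ) h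
    (by simp [colorChain_self]) fun u w hw hb ih => ?_
  rw [colorChain_cons hw hb, colorChain_append hb.symm, colorChain_of_unseparated hw.symm, ih]
  simp [hτ u w]

end Chain

theorem color_eq_and_unseparated_of_colorChain_eq {V V' X : Type*} [Finite V] [Finite V']
    {G : SimpleGraph V} {G' : SimpleGraph V'} {c : V → V → X} {c' : V' → V' → X} {u v : V}
    {u' v' : V'} (hu : Unseparated G u v) (hr' : G'.Reachable u' v')
    (el : colorChain G c u v = colorChain G' c' u' v') :
    c u v = c' u' v' ∧ Unseparated G' u' v' := by
  rw [colorChain_of_unseparated hu, eq_comm] at el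
  obtain ⟨w', hw', hb', e, el'⟩ := exists_unseparated_of_colorChain_eq_cons hr' el
  obtain rfl := (colorChain_eq_nil_iff hb'.reachable_right).1 el'
  exact ⟨e.symm, hw'⟩

section Regions

variable {V : Type*} [Fintype V] {G : SimpleGraph V} {t u w x : V}

open Classical in
/-- The vertices that can be reached from `u` only through `w`. -/
noncomputable def beyond (G : SimpleGraph V) (u w : V) : Finset V :=
  Finset.univ.filter (Between G u w)

open Classical in
/-- The vertices that can be reached from `u` without passing through `w`. -/
noncomputable def before (G : SimpleGraph V) (u w : V) : Finset V :=
  Finset.univ.filter (ReachableAvoiding G w u)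

open Classical in
/-- The vertices not separated from `w`. -/
noncomputable def unsepNbrs (G : SimpleGraph V) (w : V) : Finset V :=
  Finset.univ.filter (Unseparated G w)

open Classical in
/-- The vertices that follow `w` in chains of cut vertices starting with `u` and `w`. -/
noncomputable def nextVerts (G : SimpleGraph V) (u w : V) : Finset V :=
  Finset.univ.filter fun x => Unseparated G w x ∧ Between G u w x

open Classical in
/-- The vertices separated neither from `u` nor from `w`. -/
noncomputable def commonVerts (G : SimpleGraph V) (u w : V) : Finset V :=
  Finset.univ.filter fun x => Unseparated G u x ∧ Unseparated G x w

theorem mem_beyond : t ∈ beyond G u w ↔ Between G u w t := by simp [beyond]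

theorem mem_before : t ∈ before G u w ↔ ReachableAvoiding G w u t := by simp [before]

theorem mem_unsepNbrs : t ∈ unsepNbrs G w ↔ Unseparated G w t := by simp [unsepNbrs]

theorem mem_nextVerts : t ∈ nextVerts G u w ↔ Unseparated G w t ∧ Between G u w t := by
  simp [nextVerts]

theorem mem_commonVerts : t ∈ commonVerts G u w ↔ Unseparated G u t ∧ Unseparated G t w := by
  simp [commonVerts]

theorem compVerts_val (G : SimpleGraph V) (u w : V) :
    (compVerts G u).val = (beyond G u w).val + (before G u w).val := by
  refine val_eq_add_of_mem_iff (fun t => ?_) fun t ht ht' => (mem_beyond.1 ht).2 (mem_before.1 ht')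
  rw [mem_compVerts, mem_beyond, mem_before]
  refine ⟨fun h => ?_, fun h => h.elim And.left ReachableAvoiding.reachable⟩
  exact or_iff_not_imp_right.2 fun h' => ⟨h, h'⟩

theorem compVerts_val_eq_bind (G : SimpleGraph V) (w : V) :
    (compVerts G w).val = w ::ₘ (unsepNbrs G w).val.bind fun x => (beyond G w x).val := by
  rw [← Multiset.singleton_add, ← Finset.singleton_val]
  refine val_eq_add_bind_of_mem_iff (fun t => ?_) ?_ ?_
  · simp only [mem_compVerts, Finset.mem_singleton, mem_unsepNbrs, mem_beyond]
    constructor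
    · exact fun h => or_iff_not_imp_left.2 fun hne => exists_unseparated_between h (Ne.symm hne)
    · rintro (rfl | ⟨x, -, hb⟩)
      exacts [.refl _, hb.1]
  · simp only [Finset.mem_singleton, mem_unsepNbrs, mem_beyond]
    rintro _ rfl x hx hb
    exact hb.2 (.refl hx.ne.symm)
  · simp only [mem_unsepNbrs, mem_beyond]
    exact fun x hx x' hx' t => hx.eq_of_between hx'

theorem beyond_val_eq_bind (h : Unseparated G u w) :
    (beyond G u w).val = w ::ₘ (nextVerts G u w).val.bind fun x => (beyond G w x).val := by
  rw [← Multiset.singleton_add, ← Finset.singleton_val]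
  refine val_eq_add_bind_of_mem_iff (fun t => ?_) ?_ ?_
  · simp only [Finset.mem_singleton, mem_nextVerts, mem_beyond]
    constructor
    · refine fun hb => or_iff_not_imp_left.2 fun hne => ?_
      obtain ⟨x, hx, hb'⟩ := exists_unseparated_between hb.reachable_right (Ne.symm hne)
      exact ⟨x, ⟨hx, (between_iff_of_between h.reachable hb' hx.ne.symm).2 hb⟩, hb'⟩
    · rintro (rfl | ⟨x, ⟨hx, hb⟩, hb'⟩)
      exacts [.right h.reachable, (between_iff_of_between h.reachable hb' hx.ne.symm).1 hb]
  · simp only [Finset.mem_singleton, mem_nextVerts, mem_beyond]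
    rintro _ rfl x ⟨hx, -⟩ hb
    exact hb.2 (.refl hx.ne.symm)
  · simp only [mem_nextVerts, mem_beyond]
    exact fun x hx x' hx' t => hx.1.eq_of_between hx'.1

theorem unsepNbrs_val (h : Unseparated G u w) :
    (unsepNbrs G w).val = (nextVerts G u w).val + u ::ₘ (commonVerts G u w).val := by
  have hu : u ∉ commonVerts G u w := fun hu => (mem_commonVerts.1 hu).1.ne rfl
  rw [← Finset.cons_val hu]
  refine val_eq_add_of_mem_iff (fun x => ?_) fun x => ?_
  · simp only [mem_unsepNbrs, mem_nextVerts, Finset.mem_cons, mem_commonVerts]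
    constructor
    · refine fun hx => or_iff_not_imp_left.2 fun hn => or_iff_not_imp_left.2 fun hxu => ?_
      exact ⟨by_contra fun hux => hn ⟨hx, (h.between_iff hx hxu).2 hux⟩, hx.symm⟩
    · rintro (hx | rfl | hx)
      exacts [hx.1, h.symm, hx.2.symm]
  · simp only [mem_nextVerts, Finset.mem_cons, mem_commonVerts]
    rintro ⟨hx, hb⟩ (rfl | hc)
    · exact hb.2 (.refl h.ne.symm)
    · exact (h.between_iff hx hc.1.ne.symm).1 hb hc.1

theorem before_val (h : Unseparated G u w) :
    (before G u w).val =
      (beyond G w u).val + (commonVerts G u w).val.bind fun x => (beyond G u x).val := by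
  refine val_eq_add_bind_of_mem_iff (fun t => ?_) ?_ ?_
  · simp only [mem_before, mem_beyond, mem_commonVerts]
    constructor
    · refine fun ht => or_iff_not_imp_left.2 fun hn => ?_
      have hut : u ≠ t := by
        rintro rfl
        exact hn (.right h.reachable.symm)
      obtain ⟨x, hx, hb⟩ := exists_unseparated_between ht.reachable hut
      have hxw : x ≠ w := by
        rintro rfl
        exact hb.2 ht
      refine ⟨x, ⟨hx, by_contra fun hnx => hn ?_⟩, hb⟩
      exact (between_iff_of_between h.reachable.symm hb hx.ne.symm).1
        ((h.symm.between_iff hx hxw).2 fun hwx => hnx hwx.symm)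
    · rintro (hb | ⟨x, ⟨hx, hxw⟩, hb⟩)
      · exact hb.avoiding_left h.ne
      · by_contra hn
        exact hxw.ne (hx.eq_of_between h hb ⟨hb.1, hn⟩)
  · simp only [mem_beyond, mem_commonVerts]
    rintro t ht x ⟨hx, hxw⟩ hb
    exact (h.symm.between_iff hx hxw.ne).1
      ((between_iff_of_between h.reachable.symm hb hx.ne.symm).2 ht) hxw.symm
  · simp only [mem_commonVerts, mem_beyond]
    exact fun x hx x' hx' t => hx.1.eq_of_between hx'.1

end Regions

/-- Colors `c` and `c'` of pairs of connected vertices that are stable under the refinement of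
co-sparsified 2-FWL: `τ` recovers the color of `(v, u)` from that of `(u, v)`, `comp` is the
refinement of diagonal pairs over their component, and `common` is the refinement of unseparated
pairs over their blocks. -/
structure IsBlockStable {V V' X : Type*} [Fintype V] [Fintype V'] (G : SimpleGraph V)
    (G' : SimpleGraph V') (c : V → V → X) (c' : V' → V' → X) (τ : X → X) : Prop where
  swap : ∀ u v, c v u = τ (c u v)
  swap' : ∀ u v, c' v u = τ (c' u v)
  left : ∀ {u v u' v'}, G.Reachable u v → G'.Reachable u' v' → c u v = c' u' v' →
    c u u = c' u' u'
  unsep : ∀ {u v u' v'}, G.Reachable u v → G'.Reachable u' v' → c u v = c' u' v' →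
    (Unseparated G u v ↔ Unseparated G' u' v')
  comp : ∀ {u u'}, c u u = c' u' u' →
    (compVerts G u).val.map (c u) = (compVerts G' u').val.map (c' u')
  common : ∀ {u v u' v'}, Unseparated G u v → Unseparated G' u' v' → c u v = c' u' v' →
    ((commonVerts G u v).val.map fun t => (c u t, c t v)) =
      (commonVerts G' u' v').val.map fun t => (c' u' t, c' t v')

section ChainDecomposition

variable {V X : Type*} [Fintype V] {G : SimpleGraph V} {c : V → V → X} {τ : X → X} {u v w : V}

theorem unsepNbrs_val_eq_filter [DecidablePred (Unseparated G w)] :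
    (unsepNbrs G w).val = (compVerts G w).val.filter (Unseparated G w) := by
  rw [← Finset.filter_val]
  congr 1
  ext t
  simp only [mem_unsepNbrs, Finset.mem_filter, mem_compVerts]
  exact ⟨fun h => ⟨h.reachable, h⟩, And.right⟩

theorem map_bind_beyond_eq_bind {s : Multiset V} (hs : ∀ x ∈ s, Unseparated G w x) :
    (s.bind fun x => (beyond G w x).val).map (colorChain G c w) =
      s.bind fun x => ((beyond G w x).val.map (colorChain G c x)).map (c w x :: ·) := by
  rw [Multiset.map_bind]
  refine Multiset.bind_congr fun x hx => ?_
  rw [Multiset.map_map]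
  exact Multiset.map_congr rfl fun t ht => colorChain_cons (hs x hx) (mem_beyond.1 ht)

theorem beyond_map_eq (hu : Unseparated G u w) :
    (beyond G u w).val.map (colorChain G c w) = [] ::ₘ (nextVerts G u w).val.bind fun x =>
      ((beyond G w x).val.map (colorChain G c x)).map (c w x :: ·) := by
  rw [beyond_val_eq_bind hu, Multiset.map_cons, colorChain_self,
    map_bind_beyond_eq_bind fun x hx => (mem_nextVerts.1 hx).1]

theorem compVerts_map_eq :
    (compVerts G w).val.map (colorChain G c w) = [] ::ₘ (unsepNbrs G w).val.bind fun x =>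
      ((beyond G w x).val.map (colorChain G c x)).map (c w x :: ·) := by
  rw [compVerts_val_eq_bind, Multiset.map_cons, colorChain_self,
    map_bind_beyond_eq_bind fun x => mem_unsepNbrs.1]

theorem card_beyond_lt (hu : Unseparated G u w) {x : V} (hx : x ∈ nextVerts G u w) :
    (beyond G w x).card < (beyond G u w).card := by
  rw [← Finset.card_val (beyond G u w), beyond_val_eq_bind hu, Multiset.card_cons,
    Nat.lt_succ_iff, Multiset.card_bind]
  exact Multiset.single_le_sum (fun _ _ => Nat.zero_le _) _
    (Multiset.mem_map_of_mem (fun x => Multiset.card (beyond G w x).val) hx)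

theorem compVerts_map_pair_eq (hτ : ∀ u v, c v u = τ (c u v)) :
    ((compVerts G u).val.map fun t => (colorChain G c u t, colorChain G c t u)) =
      ((compVerts G u).val.map (colorChain G c u)).map fun l => (l, l.reverse.map τ) := by
  rw [Multiset.map_map]
  refine Multiset.map_congr rfl fun t ht => ?_
  rw [Function.comp_apply, colorChain_swap hτ (mem_compVerts.1 ht)]

theorem before_map_pair_eq (hτ : ∀ u v, c v u = τ (c u v)) (hu : Unseparated G u w) :
    ((before G u w).val.map fun t => (colorChain G c u t, colorChain G c t w)) =
      ((beyond G w u).val.map (colorChain G c u)).map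
          (fun l => (l, l.reverse.map τ ++ [c u w])) +
        (commonVerts G u w).val.bind fun x => ((beyond G u x).val.map (colorChain G c x)).map
          fun l => (c u x :: l, l.reverse.map τ ++ [c x w]) := by
  rw [before_val hu, Multiset.map_add, Multiset.map_bind, Multiset.map_map]
  congr 1
  · refine Multiset.map_congr rfl fun t ht => ?_
    have hb := mem_beyond.1 ht
    rw [Function.comp_apply, ← colorChain_swap hτ hb.reachable_right,
      ← colorChain_of_unseparated hu, ← colorChain_append hb.symm]
  · refine Multiset.bind_congr fun x hx => ?_
    obtain ⟨hux, hxw⟩ := mem_commonVerts.1 hx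
    rw [Multiset.map_map]
    refine Multiset.map_congr rfl fun t ht => ?_
    have hb := mem_beyond.1 ht
    have htw : Between G t x w :=
      (hb.of_reachableAvoiding (hu.avoiding x hux.ne.symm hxw.ne)).symm
    rw [Function.comp_apply, ← colorChain_swap hτ hb.reachable_right,
      ← colorChain_of_unseparated hxw, ← colorChain_append htw, colorChain_cons hux hb]

end ChainDecomposition

namespace IsBlockStable

variable {V V' X : Type*} [Fintype V] [Fintype V'] {G : SimpleGraph V} {G' : SimpleGraph V'}
  {c : V → V → X} {c' : V' → V' → X} {τ : X → X} {u v w : V} {u' v' w' : V'}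

theorem swap_eq (h : IsBlockStable G G' c c' τ) (e : c u v = c' u' v') : c v u = c' v' u' := by
  rw [h.swap u v, h.swap' u' v', e]

theorem right (h : IsBlockStable G G' c c' τ) (hr : G.Reachable u v) (hr' : G'.Reachable u' v')
    (e : c u v = c' u' v') : c v v = c' v' v' :=
  h.left hr.symm hr'.symm (h.swap_eq e)

theorem unsepNbrs_map (h : IsBlockStable G G' c c' τ) (e : c w w = c' w' w') :
    (unsepNbrs G w).val.map (c w) = (unsepNbrs G' w').val.map (c' w') := by
  classical
  rw [unsepNbrs_val_eq_filter, unsepNbrs_val_eq_filter]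
  refine map_filter_eq_of_map_eq (h.comp e) fun t ht t' ht' e' => ?_
  exact h.unsep (mem_compVerts.1 ht) (mem_compVerts.1 ht') e'

theorem nextVerts_map (h : IsBlockStable G G' c c' τ) (hu : Unseparated G u w)
    (hu' : Unseparated G' u' w') (e : c u w = c' u' w') :
    (nextVerts G u w).val.map (c w) = (nextVerts G' u' w').val.map (c' w') := by
  have hcommon : (commonVerts G u w).val.map (c w) = (commonVerts G' u' w').val.map (c' w') :=
    map_eq_map_of_map_eq (h.common hu hu' e) fun t _ t' _ et => h.swap_eq (Prod.mk.inj et).2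
  have hunsep := h.unsepNbrs_map (h.right hu.reachable hu'.reachable e)
  rw [unsepNbrs_val hu, unsepNbrs_val hu', Multiset.map_add, Multiset.map_add, Multiset.map_cons,
    Multiset.map_cons, h.swap_eq e, hcommon] at hunsep
  exact Multiset.add_left_inj.1 hunsep

theorem beyond_map (h : IsBlockStable G G' c c' τ) (hu : Unseparated G u w)
    (hu' : Unseparated G' u' w') (e : c u w = c' u' w') :
    (beyond G u w).val.map (colorChain G c w) =
      (beyond G' u' w').val.map (colorChain G' c' w') := by
  induction hn : (beyond G u w).card using Nat.strong_induction_on generalizing u w u' w' with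
  | _ n ih =>
    rw [beyond_map_eq hu, beyond_map_eq hu']
    congr 1
    refine bind_eq_bind_of_map_eq (h.nextVerts_map hu hu' e) fun x hx x' hx' ex => ?_
    rw [ex, ih _ (hn ▸ card_beyond_lt hu hx) (mem_nextVerts.1 hx).1 (mem_nextVerts.1 hx').1 ex rfl]

theorem compVerts_map (h : IsBlockStable G G' c c' τ) (e : c w w = c' w' w') :
    (compVerts G w).val.map (colorChain G c w) =
      (compVerts G' w').val.map (colorChain G' c' w') := by
  rw [compVerts_map_eq, compVerts_map_eq]
  congr 1
  refine bind_eq_bind_of_map_eq (h.unsepNbrs_map e) fun x hx x' hx' ex => ?_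
  rw [ex, h.beyond_map (mem_unsepNbrs.1 hx) (mem_unsepNbrs.1 hx') ex]

theorem before_map (h : IsBlockStable G G' c c' τ) (hu : Unseparated G u w)
    (hu' : Unseparated G' u' w') (e : c u w = c' u' w') :
    (before G u w).val.map (colorChain G c w) =
      (before G' u' w').val.map (colorChain G' c' w') := by
  have hcomp := h.compVerts_map (h.right hu.reachable hu'.reachable e)
  rw [← compVerts_eq_of_reachable hu.reachable, ← compVerts_eq_of_reachable hu'.reachable,
    compVerts_val G u w, compVerts_val G' u' w', Multiset.map_add, Multiset.map_add,
    h.beyond_map hu hu' e] at hcomp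
  exact Multiset.add_right_inj.1 hcomp

theorem before_map_pair (h : IsBlockStable G G' c c' τ) (hu : Unseparated G u w)
    (hu' : Unseparated G' u' w') (e : c u w = c' u' w') :
    ((before G u w).val.map fun t => (colorChain G c u t, colorChain G c t w)) =
      (before G' u' w').val.map fun t => (colorChain G' c' u' t, colorChain G' c' t w') := by
  rw [before_map_pair_eq h.swap hu, before_map_pair_eq h.swap' hu',
    h.beyond_map hu.symm hu'.symm (h.swap_eq e), e]
  congr 1
  refine bind_eq_bind_of_map_eq (h.common hu hu' e) fun x hx x' hx' ex => ?_
  obtain ⟨e₁, e₂⟩ := Prod.mk.inj ex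
  rw [h.beyond_map (mem_commonVerts.1 hx).1 (mem_commonVerts.1 hx').1 e₁, e₁, e₂]

theorem before_map_left (h : IsBlockStable G G' c c' τ) (hu : Unseparated G u w)
    (hu' : Unseparated G' u' w') (hb : Between G u w v) (hb' : Between G' u' w' v')
    (e : c u w = c' u' w') (el : colorChain G c w v = colorChain G' c' w' v') :
    ((before G u w).val.map fun t => (colorChain G c u t, colorChain G c t v)) =
      (before G' u' w').val.map fun t => (colorChain G' c' u' t, colorChain G' c' t v') := by
  refine map_eq_map_of_map_eq (h.before_map_pair hu hu' e) fun t ht t' ht' et => ?_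
  obtain ⟨e₁, e₂⟩ := Prod.mk.inj et
  rw [colorChain_append (hb.of_reachableAvoiding (mem_before.1 ht)),
    colorChain_append (hb'.of_reachableAvoiding (mem_before.1 ht')), e₁, e₂, el]

theorem before_map_right (h : IsBlockStable G G' c c' τ) (hu : Unseparated G u w)
    (hu' : Unseparated G' u' w') (hb : Between G u w v) (hb' : Between G' u' w' v')
    (e : c u w = c' u' w') (el : colorChain G c w v = colorChain G' c' w' v') :
    ((before G u w).val.map fun t => (colorChain G c w t, colorChain G c t v)) =
      (before G' u' w').val.map fun t => (colorChain G' c' w' t, colorChain G' c' t v') := by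
  refine map_eq_map_of_map_eq (h.before_map hu hu' e) fun t ht t' ht' et => ?_
  have hbt := hb.of_reachableAvoiding (mem_before.1 ht)
  have hbt' := hb'.of_reachableAvoiding (mem_before.1 ht')
  rw [colorChain_append hbt, colorChain_append hbt', colorChain_swap h.swap hbt.reachable_left.symm,
    colorChain_swap h.swap' hbt'.reachable_left.symm, et, el]

theorem colorChain_induction {motive : V → V' → Prop} (h : IsBlockStable G G' c c' τ)
    (hr : G.Reachable u v) (hr' : G'.Reachable u' v') (e : c u u = c' u' u')
    (el : colorChain G c u v = colorChain G' c' u' v') (base : c v v = c' v' v' → motive v v')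
    (step : ∀ {u w u' w'}, Unseparated G u w → Unseparated G' u' w' → Between G u w v →
      Between G' u' w' v' → c u w = c' u' w' → colorChain G c w v = colorChain G' c' w' v' →
      motive w w' → motive u u') :
    motive u u' := by
  refine cutVerts_induction (motive := fun u => ∀ {u'}, G'.Reachable u' v' → c u u = c' u' u' →
    colorChain G c u v = colorChain G' c' u' v' → motive u u') hr ?_ ?_ hr' e el
  · intro u' hr' e el
    rw [colorChain_self, eq_comm, colorChain_eq_nil_iff hr'] at el
    subst el
    exact base e
  · intro u w hw hb ih u' hr' _ el
    rw [colorChain_cons hw hb, eq_comm] at el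
    obtain ⟨w', hw', hb', e', el'⟩ := exists_unseparated_of_colorChain_eq_cons hr' el
    exact step hw hw' hb hb' e'.symm el'.symm
      (ih hb'.reachable_right (h.right hw.reachable hw'.reachable e'.symm) el'.symm)

theorem right_of_colorChain_eq (h : IsBlockStable G G' c c' τ) (hr : G.Reachable u v)
    (hr' : G'.Reachable u' v') (e : c u u = c' u' u')
    (el : colorChain G c u v = colorChain G' c' u' v') : c v v = c' v' v' :=
  h.colorChain_induction (motive := fun _ _ => c v v = c' v' v') hr hr' e el id
    fun _ _ _ _ _ _ => id

/- Passing from the pair `(w, v)` to `(u, v)` only changes the first chain, in a way that depends on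
the side of `w` on which the third vertex lies. -/
theorem compVerts_map_pair (h : IsBlockStable G G' c c' τ) (hr : G.Reachable u v)
    (hr' : G'.Reachable u' v') (e : c u u = c' u' u')
    (el : colorChain G c u v = colorChain G' c' u' v') :
    ((compVerts G u).val.map fun t => (colorChain G c u t, colorChain G c t v)) =
      (compVerts G' u').val.map fun t => (colorChain G' c' u' t, colorChain G' c' t v') := by
  refine h.colorChain_induction (motive := fun u u' =>
    ((compVerts G u).val.map fun t => (colorChain G c u t, colorChain G c t v)) =
      (compVerts G' u').val.map fun t => (colorChain G' c' u' t, colorChain G' c' t v'))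
    hr hr' e el (fun e => ?_) fun {u w u' w'} hw hw' hb hb' e el ih => ?_
  · rw [compVerts_map_pair_eq h.swap, compVerts_map_pair_eq h.swap', h.compVerts_map e]
  · rw [← compVerts_eq_of_reachable hw.reachable, ← compVerts_eq_of_reachable hw'.reachable,
      compVerts_val G u w, compVerts_val G' u' w', Multiset.map_add, Multiset.map_add,
      h.before_map_right hw hw' hb hb' e el, Multiset.add_left_inj] at ih
    rw [compVerts_val G u w, compVerts_val G' u' w', Multiset.map_add, Multiset.map_add,
      h.before_map_left hw hw' hb hb' e el]
    refine congrArg (· + _) (map_eq_map_of_map_eq ih fun t ht t' ht' et => ?_)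
    obtain ⟨e₁, e₂⟩ := Prod.mk.inj et
    rw [colorChain_cons hw (mem_beyond.1 ht), colorChain_cons hw' (mem_beyond.1 ht'), e, e₁, e₂]

open Classical in
theorem pow_apply_eq_of_colorChain_eq (h : IsBlockStable G G' c c' τ) {P : Matrix V V ℝ}
    {P' : Matrix V' V' ℝ} (hP : ∀ x y, P x y ≠ 0 → G.Adj x y)
    (hP' : ∀ x y, P' x y ≠ 0 → G'.Adj x y) {n : ℕ}
    (hc : ∀ {u v u' v'}, G.Reachable u v → G'.Reachable u' v' → c u v = c' u' v' →
      ∀ k < n, (P ^ k) u v = (P' ^ k) u' v') (hr : G.Reachable u v) (hr' : G'.Reachable u' v')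
    (e : c u u = c' u' u') (el : colorChain G c u v = colorChain G' c' u' v') :
    ∀ k < n, (P ^ k) u v = (P' ^ k) u' v' := by
  refine h.colorChain_induction (motive := fun u u' => ∀ k < n, (P ^ k) u v = (P' ^ k) u' v')
    hr hr' e el (hc (.refl _) (.refl _)) fun {u w u' w'} hw hw' hb hb' e el ih k hk => ?_
  by_cases hwv : w = v
  · subst hwv
    rw [colorChain_self, eq_comm, colorChain_eq_nil_iff hb'.reachable_right] at el
    exact el ▸ hc hw.reachable hw'.reachable e k hk
  · have hwv' : w' ≠ v' := by
      rintro rfl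
      rw [colorChain_self, colorChain_eq_nil_iff hb.reachable_right] at el
      exact hwv el
    have hww := hc (.refl w) (.refl w') (h.right hw.reachable hw'.reachable e)
    refine (pow_eq_iff_updateRow_pow_eq (hc hw.reachable hw'.reachable e) hww ih hk).2 ?_
    rw [of_not_not fun hne => hb.2 (reachableAvoiding_of_updateRow_pow_ne_zero hP hwv hne),
      of_not_not fun hne => hb'.2 (reachableAvoiding_of_updateRow_pow_ne_zero hP' hwv' hne)]

end IsBlockStable

open Classical in
/-- The colors of the ends of a pair, and the chain between them if they are connected. -/
noncomputable def chainColor {V X : Type*} [Finite V] (G : SimpleGraph V) (c : V → V → X)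
    (u v : V) : X × X × Option (List X) :=
  (c u u, c v v, if G.Reachable u v then some (colorChain G c u v) else none)

section ChainColor

variable {V V' X : Type*} [Finite V] [Finite V'] {G : SimpleGraph V} {G' : SimpleGraph V'}
  {c : V → V → X} {c' : V' → V' → X} {u v : V} {u' v' : V'}

theorem chainColor_of_reachable (h : G.Reachable u v) :
    chainColor G c u v = (c u u, c v v, some (colorChain G c u v)) := by
  rw [chainColor, if_pos h]

theorem chainColor_of_not_reachable (h : ¬ G.Reachable u v) :
    chainColor G c u v = (c u u, c v v, none) := by
  rw [chainColor, if_neg h]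

theorem reachable_iff_of_chainColor_eq (e : chainColor G c u v = chainColor G' c' u' v') :
    G.Reachable u v ↔ G'.Reachable u' v' := by
  have e₂ := congrArg (fun x => x.2.2.isSome) e
  by_cases h : G.Reachable u v <;> by_cases h' : G'.Reachable u' v' <;>
    simp [chainColor, h, h'] at e₂ ⊢

theorem colorChain_eq_of_chainColor_eq (e : chainColor G c u v = chainColor G' c' u' v')
    (hr : G.Reachable u v) : colorChain G c u v = colorChain G' c' u' v' := by
  have hr' := (reachable_iff_of_chainColor_eq e).1 hr
  rw [chainColor_of_reachable hr, chainColor_of_reachable hr'] at e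
  exact Option.some.inj (congrArg (fun x => x.2.2) e)

end ChainColor

section Outside

variable {V : Type*} [Fintype V] {G : SimpleGraph V} {t u v : V}

open Classical in
/-- The vertices outside the component of `u`. -/
noncomputable def outsideVerts (G : SimpleGraph V) (u : V) : Finset V :=
  Finset.univ.filter fun t => ¬ G.Reachable u t

theorem mem_outsideVerts : t ∈ outsideVerts G u ↔ ¬ G.Reachable u t := by simp [outsideVerts]

theorem univ_val_eq_add_outsideVerts (G : SimpleGraph V) (u : V) :
    (Finset.univ : Finset V).val = (compVerts G u).val + (outsideVerts G u).val :=
  val_eq_add_of_mem_iff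
    (fun t => by simp only [Finset.mem_univ, mem_compVerts, mem_outsideVerts, em])
    fun _ ht ht' => mem_outsideVerts.1 ht' (mem_compVerts.1 ht)

open Classical in
theorem outsideVerts_val_eq_add (h : ¬ G.Reachable u v) :
    (outsideVerts G u).val =
      (compVerts G v).val + (outsideVerts G u ∩ outsideVerts G v).val := by
  refine val_eq_add_of_mem_iff (fun t => ?_) fun t ht ht' =>
    mem_outsideVerts.1 (Finset.mem_inter.1 ht').2 (mem_compVerts.1 ht)
  simp only [mem_compVerts, Finset.mem_inter, mem_outsideVerts]
  have huv : G.Reachable v t → ¬ G.Reachable u t := fun hv hu => h (hu.trans hv.symm)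
  tauto

end Outside

theorem rrwp_eq_zero_of_not_reachable {V : Type} [Fintype V] {G : SimpleGraph V} {K : ℕ} {u v : V}
    (h : ¬ G.Reachable u v) : rrwp G K u v = 0 := by
  classical
  exact funext fun k => by_contra fun hk =>
    h (reachable_of_pow_ne_zero (fun _ _ => adj_of_randomWalk_ne_zero) hk)

namespace IsBlockStable

section Stable

variable {V V' X : Type*} [Fintype V] [Fintype V'] {G : SimpleGraph V} {G' : SimpleGraph V'}
  {c : V → V → X} {c' : V' → V' → X} {τ : X → X} {u v : V} {u' v' : V'}

theorem compVerts_diag_map (h : IsBlockStable G G' c c' τ) (e : c u u = c' u' u') :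
    ((compVerts G u).val.map fun t => c t t) = (compVerts G' u').val.map fun t => c' t t :=
  map_eq_map_of_map_eq (h.comp e) fun _ ht _ ht' e' =>
    h.right (mem_compVerts.1 ht) (mem_compVerts.1 ht') e'

theorem outsideVerts_diag_map (h : IsBlockStable G G' c c' τ)
    (hD : ((Finset.univ : Finset V).val.map fun u => c u u) =
      (Finset.univ : Finset V').val.map fun u => c' u u) (e : c u u = c' u' u') :
    ((outsideVerts G u).val.map fun t => c t t) = (outsideVerts G' u').val.map fun t => c' t t := by
  rw [univ_val_eq_add_outsideVerts G u, univ_val_eq_add_outsideVerts G' u', Multiset.map_add,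
    Multiset.map_add, h.compVerts_diag_map e] at hD
  exact Multiset.add_right_inj.1 hD

open Classical in
theorem outsideVerts_inter_diag_map (h : IsBlockStable G G' c c' τ)
    (hD : ((Finset.univ : Finset V).val.map fun u => c u u) =
      (Finset.univ : Finset V').val.map fun u => c' u u) (hr : ¬ G.Reachable u v)
    (hr' : ¬ G'.Reachable u' v') (eu : c u u = c' u' u') (ev : c v v = c' v' v') :
    ((outsideVerts G u ∩ outsideVerts G v).val.map fun t => c t t) =
      (outsideVerts G' u' ∩ outsideVerts G' v').val.map fun t => c' t t := by
  have hout := h.outsideVerts_diag_map hD eu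
  rw [outsideVerts_val_eq_add hr, outsideVerts_val_eq_add hr', Multiset.map_add, Multiset.map_add,
    h.compVerts_diag_map ev] at hout
  exact Multiset.add_right_inj.1 hout

theorem chainColor_map_of_reachable (h : IsBlockStable G G' c c' τ)
    (hD : ((Finset.univ : Finset V).val.map fun u => c u u) =
      (Finset.univ : Finset V').val.map fun u => c' u u) (hr : G.Reachable u v)
    (hr' : G'.Reachable u' v') (eu : c u u = c' u' u') (ev : c v v = c' v' v')
    (el : colorChain G c u v = colorChain G' c' u' v') :
    ((Finset.univ : Finset V).val.map fun t => (chainColor G c u t, chainColor G c t v)) =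
      (Finset.univ : Finset V').val.map fun t =>
        (chainColor G' c' u' t, chainColor G' c' t v') := by
  rw [univ_val_eq_add_outsideVerts G u, univ_val_eq_add_outsideVerts G' u', Multiset.map_add,
    Multiset.map_add]
  congr 1
  · refine map_eq_map_of_map_eq (h.compVerts_map_pair hr hr' eu el) fun t ht t' ht' et => ?_
    obtain ⟨e₁, e₂⟩ := Prod.mk.inj et
    have ht := mem_compVerts.1 ht
    have ht' := mem_compVerts.1 ht'
    rw [chainColor_of_reachable ht, chainColor_of_reachable ht',
      chainColor_of_reachable (ht.symm.trans hr), chainColor_of_reachable (ht'.symm.trans hr'),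
      eu, ev, e₁, e₂, h.right_of_colorChain_eq ht ht' eu e₁]
  · refine map_eq_map_of_map_eq (h.outsideVerts_diag_map hD eu) fun t ht t' ht' et => ?_
    have ht := mem_outsideVerts.1 ht
    have ht' := mem_outsideVerts.1 ht'
    rw [chainColor_of_not_reachable ht, chainColor_of_not_reachable ht',
      chainColor_of_not_reachable fun htv => ht (hr.trans htv.symm),
      chainColor_of_not_reachable fun htv => ht' (hr'.trans htv.symm), eu, ev, et]

theorem chainColor_map_of_not_reachable (h : IsBlockStable G G' c c' τ)
    (hD : ((Finset.univ : Finset V).val.map fun u => c u u) =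
      (Finset.univ : Finset V').val.map fun u => c' u u) (hr : ¬ G.Reachable u v)
    (hr' : ¬ G'.Reachable u' v') (eu : c u u = c' u' u') (ev : c v v = c' v' v') :
    ((Finset.univ : Finset V).val.map fun t => (chainColor G c u t, chainColor G c t v)) =
      (Finset.univ : Finset V').val.map fun t =>
        (chainColor G' c' u' t, chainColor G' c' t v') := by
  classical
  rw [univ_val_eq_add_outsideVerts G u, univ_val_eq_add_outsideVerts G' u',
    outsideVerts_val_eq_add hr, outsideVerts_val_eq_add hr']
  simp only [Multiset.map_add]
  congr 1
  · refine map_eq_map_of_map_eq (h.compVerts_map eu) fun t ht t' ht' et => ?_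
    have ht := mem_compVerts.1 ht
    have ht' := mem_compVerts.1 ht'
    rw [chainColor_of_reachable ht, chainColor_of_reachable ht',
      chainColor_of_not_reachable fun htv => hr (ht.trans htv),
      chainColor_of_not_reachable fun htv => hr' (ht'.trans htv),
      eu, ev, et, h.right_of_colorChain_eq ht ht' eu et]
  congr 1
  · refine map_eq_map_of_map_eq (h.compVerts_map ev) fun t ht t' ht' et => ?_
    have ht := mem_compVerts.1 ht
    have ht' := mem_compVerts.1 ht'
    rw [chainColor_of_not_reachable fun hut => hr (hut.trans ht.symm),
      chainColor_of_not_reachable fun hut => hr' (hut.trans ht'.symm),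
      chainColor_of_reachable ht.symm, chainColor_of_reachable ht'.symm,
      eu, ev, h.right_of_colorChain_eq ht ht' ev et, colorChain_swap h.swap ht,
      colorChain_swap h.swap' ht', et]
  · refine map_eq_map_of_map_eq (h.outsideVerts_inter_diag_map hD hr hr' eu ev)
      fun t ht t' ht' et => ?_
    obtain ⟨hut, hvt⟩ := Finset.mem_inter.1 ht
    obtain ⟨hut', hvt'⟩ := Finset.mem_inter.1 ht'
    rw [chainColor_of_not_reachable (mem_outsideVerts.1 hut),
      chainColor_of_not_reachable (mem_outsideVerts.1 hut'),
      chainColor_of_not_reachable fun htv => mem_outsideVerts.1 hvt htv.symm,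
      chainColor_of_not_reachable fun htv => mem_outsideVerts.1 hvt' htv.symm, eu, ev, et]

theorem chainColor_map (h : IsBlockStable G G' c c' τ)
    (hD : ((Finset.univ : Finset V).val.map fun u => c u u) =
      (Finset.univ : Finset V').val.map fun u => c' u u)
    (e : chainColor G c u v = chainColor G' c' u' v') :
    ((Finset.univ : Finset V).val.map fun t => (chainColor G c u t, chainColor G c t v)) =
      (Finset.univ : Finset V').val.map fun t =>
        (chainColor G' c' u' t, chainColor G' c' t v') := by
  have eu : c u u = c' u' u' := congrArg Prod.fst e
  have ev : c v v = c' v' v' := congrArg (fun x => x.2.1) e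
  have hiff := reachable_iff_of_chainColor_eq e
  by_cases hr : G.Reachable u v
  · exact h.chainColor_map_of_reachable hD hr (hiff.1 hr) eu ev
      (colorChain_eq_of_chainColor_eq e hr)
  · exact h.chainColor_map_of_not_reachable hD hr (mt hiff.2 hr) eu ev

theorem chainColor_pairs_map (h : IsBlockStable G G' c c' τ)
    (hD : ((Finset.univ : Finset V).val.map fun u => c u u) =
      (Finset.univ : Finset V').val.map fun u => c' u u) :
    ((Finset.univ : Finset (V × V)).val.map fun p => chainColor G c p.1 p.2) =
      (Finset.univ : Finset (V' × V')).val.map fun p => chainColor G' c' p.1 p.2 := by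
  rw [← Finset.univ_product_univ, ← Finset.univ_product_univ, Finset.product_val,
    Finset.product_val]
  simp only [SProd.sprod, Multiset.product, Multiset.map_bind, Multiset.map_map, Function.comp_def]
  refine bind_eq_bind_of_map_eq hD fun u _ u' _ e => ?_
  have hdiag : chainColor G c u u = chainColor G' c' u' u' := by
    rw [chainColor_of_reachable (.refl _), chainColor_of_reachable (.refl _), colorChain_self,
      colorChain_self, e]
  exact map_eq_map_of_map_eq (h.chainColor_map hD hdiag) fun t _ t' _ et => (Prod.mk.inj et).1

end Stable

theorem stdRep_eq {V V' I : Type} {X : Type*} [Fintype V] [Fintype V'] {G : SimpleGraph V}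
    {G' : SimpleGraph V'} {c : V → V → X} {c' : V' → V' → X} {τ : X → X}
    (h : IsBlockStable G G' c c' τ)
    (hD : ((Finset.univ : Finset V).val.map fun u => c u u) =
      (Finset.univ : Finset V').val.map fun u => c' u u)
    (M : MessagePassing I) {h₀ : V → V → I} {h₀' : V' → V' → I}
    (h0 : ∀ {u v u' v'}, chainColor G c u v = chainColor G' c' u' v' → h₀ u v = h₀' u' v')
    (l : ℕ) {u v : V} {u' v' : V'} (e : chainColor G c u v = chainColor G' c' u' v') :
    M.stdRep h₀ l u v = M.stdRep h₀' l u' v' := by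
  induction l generalizing u v u' v' with
  | zero => exact h0 e
  | succ l ih =>
    refine congrArg₂ (M.Φ l) (ih e) (congrArg (M.agg l) ?_)
    refine map_eq_map_of_map_eq (h.chainColor_map hD e) fun t _ t' _ et => ?_
    rw [ih (Prod.mk.inj et).1, ih (Prod.mk.inj et).2]

section Init

variable {dx de K : ℕ} {X : Type*} {G H : AttrGraph dx de} {c : G.V → G.V → X}
  {c' : H.V → H.V → X} {τ : X → X}

theorem edge_eq_of_colorChain_eq
    (h0 : ∀ {u v u' v'}, G.graph.Reachable u v → H.graph.Reachable u' v' → c u v = c' u' v' →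
      initRep K G u v = initRep K H u' v') {u v : G.V} {u' v' : H.V}
    (hr : G.graph.Reachable u v) (hr' : H.graph.Reachable u' v')
    (el : colorChain G.graph c u v = colorChain H.graph c' u' v') : G.e u v = H.e u' v' := by
  by_cases hu : Unseparated G.graph u v
  · obtain ⟨e, -⟩ := color_eq_and_unseparated_of_colorChain_eq hu hr' el
    exact congrArg (fun x => x.2.2.1) (h0 hr hr' e)
  · have hu' : ¬ Unseparated H.graph u' v' := fun hu' =>
      hu (color_eq_and_unseparated_of_colorChain_eq hu' hr el.symm).2
    rw [G.e_zero u v (mt .of_adj hu), H.e_zero u' v' (mt .of_adj hu')]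

theorem rrwp_eq_of_colorChain_eq (h : IsBlockStable G.graph H.graph c c' τ)
    (h0 : ∀ {u v u' v'}, G.graph.Reachable u v → H.graph.Reachable u' v' → c u v = c' u' v' →
      initRep K G u v = initRep K H u' v') {u v : G.V} {u' v' : H.V}
    (hr : G.graph.Reachable u v) (hr' : H.graph.Reachable u' v') (e : c u u = c' u' u')
    (el : colorChain G.graph c u v = colorChain H.graph c' u' v') :
    rrwp G.graph K u v = rrwp H.graph K u' v' := by
  classical
  funext k
  exact h.pow_apply_eq_of_colorChain_eq (fun _ _ => adj_of_randomWalk_ne_zero)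
    (fun _ _ => adj_of_randomWalk_ne_zero)
    (fun hr hr' e k hk => congrArg (fun x => x.2.2.2 ⟨k, hk⟩) (h0 hr hr' e)) hr hr' e el k k.2

theorem initRep_eq_of_chainColor_eq (h : IsBlockStable G.graph H.graph c c' τ)
    (h0 : ∀ {u v u' v'}, G.graph.Reachable u v → H.graph.Reachable u' v' → c u v = c' u' v' →
      initRep K G u v = initRep K H u' v') {u v : G.V} {u' v' : H.V}
    (e : chainColor G.graph c u v = chainColor H.graph c' u' v') :
    initRep K G u v = initRep K H u' v' := by
  have eu : c u u = c' u' u' := congrArg Prod.fst e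
  have ev : c v v = c' v' v' := congrArg (fun x => x.2.1) e
  have xu : G.x u = H.x u' := congrArg Prod.fst (h0 (.refl _) (.refl _) eu)
  have xv : G.x v = H.x v' := congrArg Prod.fst (h0 (.refl _) (.refl _) ev)
  have hiff := reachable_iff_of_chainColor_eq e
  by_cases hr : G.graph.Reachable u v
  · have el := colorChain_eq_of_chainColor_eq e hr
    rw [initRep, initRep, xu, xv, edge_eq_of_colorChain_eq h0 hr (hiff.1 hr) el,
      h.rrwp_eq_of_colorChain_eq h0 hr (hiff.1 hr) eu el]
  · have hr' := mt hiff.2 hr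
    rw [initRep, initRep, xu, xv, G.e_zero u v (mt SimpleGraph.Adj.reachable hr),
      H.e_zero u' v' (mt SimpleGraph.Adj.reachable hr'), rrwp_eq_zero_of_not_reachable hr,
      rrwp_eq_zero_of_not_reachable hr']

theorem standardGNN_out_eq (h : IsBlockStable G.graph H.graph c c' τ)
    (hD : ((Finset.univ : Finset G.V).val.map fun u => c u u) =
      (Finset.univ : Finset H.V).val.map fun u => c' u u)
    (h0 : ∀ {u v u' v'}, G.graph.Reachable u v → H.graph.Reachable u' v' → c u v = c' u' v' →
      initRep K G u v = initRep K H u' v') (M : StandardGNN dx de K) : M.out G = M.out H := by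
  refine congrArg M.Ψ (congrArg M.readAgg ?_)
  exact map_eq_map_of_map_eq (h.chainColor_pairs_map hD) fun p _ p' _ e =>
    h.stdRep_eq hD _ (h.initRep_eq_of_chainColor_eq h0) _ e

end Init

end IsBlockStable

/-! ### Co-sparsified colorings -/

section SparseNeighborhoods

variable {V : Type} {G : SimpleGraph V} {u v : V}

theorem spInteraction_left (h : G.Reachable u v) : SpInteraction G u u v := by
  by_cases hne : u = v
  exacts [⟨h, .inl ⟨hne, .refl _⟩⟩, ⟨h, .inr ⟨hne, .inl rfl⟩⟩]

theorem spInteraction_right (h : G.Reachable u v) : SpInteraction G u v v := by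
  by_cases hne : u = v
  exacts [⟨h, .inl ⟨hne, h⟩⟩, ⟨h, .inr ⟨hne, .inr (.inl rfl)⟩⟩]

variable [Fintype V]

theorem spNbr_self (G : SimpleGraph V) (u : V) : spNbr G u u = compVerts G u := by
  ext t
  rw [mem_spNbr, spInteraction_iff, mem_compVerts]
  simp

theorem spNbr_comm (G : SimpleGraph V) (u v : V) : spNbr G u v = spNbr G v u := by
  ext t
  rw [mem_spNbr, mem_spNbr]
  exact ⟨.symm, .symm⟩

namespace Unseparated

open Classical in
theorem commonVerts_eq_filter (h : Unseparated G u v) :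
    commonVerts G u v = (spNbr G u v).filter fun t => t ≠ u ∧ t ≠ v := by
  ext t
  rw [mem_commonVerts, Finset.mem_filter, mem_spNbr, spInteraction_iff]
  constructor
  · rintro ⟨hut, htv⟩
    exact ⟨⟨h.reachable, .inr ⟨h.ne, .inr (.inr ⟨hut, htv, h⟩)⟩⟩, hut.ne.symm, htv.ne⟩
  · rintro ⟨⟨-, ⟨huv, -⟩ | ⟨-, htu | htv | ⟨hut, htv, -⟩⟩⟩, hne, hne'⟩
    exacts [absurd huv h.ne, absurd htu hne, absurd htv hne', ⟨hut, htv⟩]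

end Unseparated

theorem unseparated_iff_adj_or_exists :
    Unseparated G u v ↔ G.Adj u v ∨ (u ≠ v ∧ ∃ t ∈ spNbr G u v, t ≠ u ∧ t ≠ v) := by
  classical
  constructor
  · refine fun hu => or_iff_not_imp_left.2 fun ha => ⟨hu.ne, ?_⟩
    obtain ⟨t, ht⟩ := hu.exists_of_not_adj ha
    have hmem : t ∈ commonVerts G u v := mem_commonVerts.2 ht
    rw [hu.commonVerts_eq_filter, Finset.mem_filter] at hmem
    exact ⟨t, hmem⟩
  · rintro (ha | ⟨hne, t, ht, htu, htv⟩)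
    · exact .of_adj ha
    · rw [mem_spNbr, spInteraction_iff] at ht
      rcases ht with ⟨-, ⟨huv, -⟩ | ⟨-, htu' | htv' | ⟨-, -, hu⟩⟩⟩
      exacts [absurd huv hne, absurd htu' htu, absurd htv' htv, hu]

open Classical in
theorem degree_eq_card_filter_spNbr :
    G.degree u = ((spNbr G u u).val.filter (G.Adj u)).card := by
  rw [← Finset.filter_val, Finset.card_val, ← SimpleGraph.card_neighborFinset_eq_degree]
  congr 1
  ext t
  rw [SimpleGraph.mem_neighborFinset, Finset.mem_filter, spNbr_self, mem_compVerts]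
  exact ⟨fun h => ⟨h.reachable, h⟩, And.right⟩

end SparseNeighborhoods

/-- Equality of the colors `c` and `c'` of pairs of connected vertices is stable under refinement
over the co-sparsified neighborhoods, and equal colors agree on whether the pair is diagonal and
whether it is an edge. -/
structure IsSparseStable {V V' : Type} {X : Type*} [Fintype V] [Fintype V'] (G : SimpleGraph V)
    (G' : SimpleGraph V') (c : V → V → X) (c' : V' → V' → X) : Prop where
  diag : ∀ {u v u' v'}, G.Reachable u v → G'.Reachable u' v' → c u v = c' u' v' →
    (u = v ↔ u' = v')
  adj : ∀ {u v u' v'}, G.Reachable u v → G'.Reachable u' v' → c u v = c' u' v' →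
    (G.Adj u v ↔ G'.Adj u' v')
  stable : ∀ {u v u' v'}, G.Reachable u v → G'.Reachable u' v' → c u v = c' u' v' →
    ((spNbr G u v).val.map fun t => (c u t, c t v)) =
      (spNbr G' u' v').val.map fun t => (c' u' t, c' t v')

namespace IsSparseStable

section General

variable {V V' : Type} {X : Type*} [Fintype V] [Fintype V']
  {G : SimpleGraph V} {G' : SimpleGraph V'} {c : V → V → X} {c' : V' → V' → X}
  {u v : V} {u' v' : V'}

theorem symm (h : IsSparseStable G G' c c') : IsSparseStable G' G c' c where
  diag hr hr' e := (h.diag hr' hr e.symm).symm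
  adj hr hr' e := (h.adj hr' hr e.symm).symm
  stable hr hr' e := (h.stable hr' hr e.symm).symm

theorem left (h : IsSparseStable G G' c c') (hr : G.Reachable u v) (hr' : G'.Reachable u' v')
    (e : c u v = c' u' v') : c u u = c' u' u' := by
  obtain ⟨t', ht', et⟩ :=
    exists_mem_of_map_eq (h.stable hr hr' e) (mem_spNbr.2 (spInteraction_left hr))
  obtain ⟨e₁, -⟩ := Prod.mk.inj et
  obtain rfl := (h.diag (.refl _) (mem_spNbr.1 ht').reachable_left e₁).1 rfl
  exact e₁

theorem right (h : IsSparseStable G G' c c') (hr : G.Reachable u v) (hr' : G'.Reachable u' v')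
    (e : c u v = c' u' v') : c v v = c' v' v' := by
  obtain ⟨t', ht', et⟩ :=
    exists_mem_of_map_eq (h.stable hr hr' e) (mem_spNbr.2 (spInteraction_right hr))
  obtain ⟨-, e₂⟩ := Prod.mk.inj et
  obtain rfl := (h.diag (.refl _) (mem_spNbr.1 ht').reachable_right e₂).1 rfl
  exact e₂

theorem ne_and_ne_iff (h : IsSparseStable G G' c c') {t : V} {t' : V'} (ht : t ∈ spNbr G u v)
    (ht' : t' ∈ spNbr G' u' v') (e : (c u t, c t v) = (c' u' t', c' t' v')) :
    t ≠ u ∧ t ≠ v ↔ t' ≠ u' ∧ t' ≠ v' := by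
  obtain ⟨e₁, e₂⟩ := Prod.mk.inj e
  have ht := mem_spNbr.1 ht
  have ht' := mem_spNbr.1 ht'
  rw [ne_comm, ne_comm (a := t'), ne_eq, ne_eq, ne_eq, ne_eq,
    h.diag ht.reachable_left ht'.reachable_left e₁,
    h.diag ht.reachable_right ht'.reachable_right e₂]

open Classical in
theorem degree_eq (h : IsSparseStable G G' c c') (e : c u u = c' u' u') :
    G.degree u = G'.degree u' := by
  have hadj := map_filter_eq_of_map_eq (h.stable (.refl _) (.refl _) e)
    (p := G.Adj u) (p' := G'.Adj u') fun t ht t' ht' et =>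
      h.adj (mem_spNbr.1 ht).reachable_left (mem_spNbr.1 ht').reachable_left (Prod.mk.inj et).1
  rw [degree_eq_card_filter_spNbr, degree_eq_card_filter_spNbr]
  simpa only [Multiset.card_map] using congrArg Multiset.card hadj

theorem unseparated (h : IsSparseStable G G' c c') (hr : G.Reachable u v)
    (hr' : G'.Reachable u' v') (e : c u v = c' u' v') (hu : Unseparated G u v) :
    Unseparated G' u' v' := by
  rw [unseparated_iff_adj_or_exists] at hu ⊢
  refine hu.imp (h.adj hr hr' e).1 fun ⟨hne, t, ht, htuv⟩ => ⟨mt (h.diag hr hr' e).2 hne, ?_⟩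
  obtain ⟨t', ht', et⟩ := exists_mem_of_map_eq (h.stable hr hr' e) ht
  exact ⟨t', ht', (h.ne_and_ne_iff ht ht' et).1 htuv⟩

theorem commonVerts_map (h : IsSparseStable G G' c c') (hu : Unseparated G u v)
    (hu' : Unseparated G' u' v') (e : c u v = c' u' v') :
    ((commonVerts G u v).val.map fun t => (c u t, c t v)) =
      (commonVerts G' u' v').val.map fun t => (c' u' t, c' t v') := by
  classical
  rw [hu.commonVerts_eq_filter, hu'.commonVerts_eq_filter, Finset.filter_val, Finset.filter_val]
  exact map_filter_eq_of_map_eq (h.stable hu.reachable hu'.reachable e)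
    fun t ht t' ht' et => h.ne_and_ne_iff ht ht' et

/- Both directions are recorded because a chain of cut vertices has to be read from either end. -/
theorem isBlockStable (h : IsSparseStable G G' c c')
    (hswap : ∀ {u v u' v'}, G.Reachable u v → G'.Reachable u' v' → c u v = c' u' v' →
      c v u = c' v' u') :
    IsBlockStable G G' (fun u v => (c u v, c v u)) (fun u v => (c' u v, c' v u)) Prod.swap where
  swap _ _ := rfl
  swap' _ _ := rfl
  left hr hr' e := by rw [h.left hr hr' (Prod.mk.inj e).1]
  unsep hr hr' e :=
    ⟨h.unseparated hr hr' (Prod.mk.inj e).1, h.symm.unseparated hr' hr (Prod.mk.inj e).1.symm⟩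
  comp {u u'} e := by
    have hstable := h.stable (.refl _) (.refl _) (Prod.mk.inj e).1
    rwa [spNbr_self, spNbr_self] at hstable
  common {u v u' v'} hu hu' e := by
    refine map_eq_map_of_map_eq (h.commonVerts_map hu hu' (Prod.mk.inj e).1)
      fun t ht t' ht' et => ?_
    obtain ⟨e₁, e₂⟩ := Prod.mk.inj et
    obtain ⟨hut, htv⟩ := mem_commonVerts.1 ht
    obtain ⟨hut', htv'⟩ := mem_commonVerts.1 ht'
    rw [e₁, e₂, hswap hut.reachable hut'.reachable e₁, hswap htv.reachable htv'.reachable e₂]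

end General

variable {dx de K : ℕ} {X : Type*} {G H : AttrGraph dx de} {c : G.V → G.V → X}
  {c' : H.V → H.V → X} {u v : G.V} {u' v' : H.V}

theorem initRep_swap (h : IsSparseStable G.graph H.graph c c') (hr : G.graph.Reachable u v)
    (hr' : H.graph.Reachable u' v') (e : c u v = c' u' v')
    (hi : initRep K G u v = initRep K H u' v') : initRep K G v u = initRep K H v' u' := by
  classical
  by_cases huv : u = v
  · obtain rfl := (h.diag hr hr' e).1 huv
    subst huv
    exact hi
  obtain ⟨xu, hi⟩ := Prod.mk.inj hi
  obtain ⟨xv, hi⟩ := Prod.mk.inj hi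
  obtain ⟨euv, hp⟩ := Prod.mk.inj hi
  have hpos : G.graph.degree v ≠ 0 := (hr.symm.degree_pos_left (Ne.symm huv)).ne'
  rw [initRep, initRep, xu, xv, G.e_symm, H.e_symm, euv]
  congr 3
  exact funext fun k => randomWalk_pow_swap_eq (h.degree_eq (h.left hr hr' e))
    (h.degree_eq (h.right hr hr' e)) hpos (congrFun hp k)

theorem spRep_swap (h : IsSparseStable G.graph H.graph c c')
    (h0 : ∀ {u v u' v'}, G.graph.Reachable u v → H.graph.Reachable u' v' → c u v = c' u' v' →
      initRep K G u v = initRep K H u' v') (M : MessagePassing (InitRep dx de K)) (l : ℕ)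
    (hr : G.graph.Reachable u v) (hr' : H.graph.Reachable u' v') (e : c u v = c' u' v') :
    M.spRep G.graph (initRep K G) l v u = M.spRep H.graph (initRep K H) l v' u' := by
  induction l generalizing u v u' v' with
  | zero => exact h.initRep_swap hr hr' e (h0 hr hr' e)
  | succ l ih =>
    rw [MessagePassing.spRep_succ_of_reachable hr.symm,
      MessagePassing.spRep_succ_of_reachable hr'.symm, ih hr hr' e]
    congr 2
    rw [spNbr_comm, spNbr_comm H.graph]
    refine map_eq_map_of_map_eq (h.stable hr hr' e) fun t ht t' ht' et => ?_
    obtain ⟨e₁, e₂⟩ := Prod.mk.inj et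
    have ht := mem_spNbr.1 ht
    have ht' := mem_spNbr.1 ht'
    rw [ih ht.reachable_left ht'.reachable_left e₁, ih ht.reachable_right ht'.reachable_right e₂]

end IsSparseStable

open Classical in
theorem univ_val_eq_bind_connectedComponent {V : Type*} [Fintype V] (G : SimpleGraph V) :
    (Finset.univ : Finset V).val = (Finset.univ.image G.connectedComponentMk).val.bind fun C =>
      ((Finset.univ : Finset V).filter fun u => u ∈ C.supp).val :=
  val_eq_bind_of_mem_iff (fun u => by simpa using ⟨u, .refl u⟩) fun C _ C' _ u hu hu' =>
    (Finset.mem_filter.1 hu).2.symm.trans (Finset.mem_filter.1 hu').2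

open Classical in
theorem filter_mem_supp_eq_univ {V : Type*} [Fintype V] {G : SimpleGraph V} (hG : G.Connected)
    (u : V) : (Finset.univ.filter fun t => t ∈ (G.connectedComponentMk u).supp) = Finset.univ :=
  Finset.filter_eq_self.2 fun _ _ => SimpleGraph.ConnectedComponent.sound (hG.preconnected _ _)

section Dominating

variable {dx de K : ℕ}

theorem CoSparsifiedGNN.diag_map_eq_of_out_eq {G H : AttrGraph dx de} {U : CoSparsifiedGNN dx de K}
    (hc : Function.Injective2 U.compOut) (hΨ : Function.Injective U.Ψ)
    (hne : ∀ a b y, U.compOut a b ≠ U.Ψ y) (hout : U.out G = U.out H) :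
    ((Finset.univ : Finset G.V).val.map fun u => U.spRep G.graph (initRep K G) U.depth u u) =
      (Finset.univ : Finset H.V).val.map fun u => U.spRep H.graph (initRep K H) U.depth u u := by
  unfold CoSparsifiedGNN.out at hout
  by_cases hG : G.graph.Connected <;> by_cases hH : H.graph.Connected
  · rw [dif_pos hG, dif_pos hH] at hout
    have hagg := U.pairAgg_injective (hc hout).1
    rwa [filter_mem_supp_eq_univ hG, filter_mem_supp_eq_univ hH] at hagg
  · rw [dif_pos hG, dif_neg hH] at hout
    exact absurd hout (hne _ _ _)
  · rw [dif_neg hG, dif_pos hH] at hout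
    exact absurd hout.symm (hne _ _ _)
  · rw [dif_neg hG, dif_neg hH] at hout
    rw [univ_val_eq_bind_connectedComponent G.graph, univ_val_eq_bind_connectedComponent H.graph,
      Multiset.map_bind, Multiset.map_bind]
    exact bind_eq_bind_of_map_eq (U.compAgg_injective (hΨ hout)) fun C _ C' _ e =>
      U.pairAgg_injective (hc e).1

theorem exists_coSparsifiedGNN_dominating {N : ℕ} {𝒢 : Set (AttrGraph dx de)}
    (hN : ∀ G ∈ 𝒢, Fintype.card G.V ≤ N) (hinit : ConsistentInit K 𝒢) :
    ∃ U : CoSparsifiedGNN dx de K, ∀ G ∈ 𝒢, ∀ H ∈ 𝒢, U.out G = U.out H →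
      ∀ M : StandardGNN dx de K, M.out G = M.out H := by
  obtain ⟨U, hL, hU, hc, hΨ, hne⟩ :=
    CoSparsifiedGNN.exists_isInjective dx de K (N * N * (N * N))
  refine ⟨U, fun G hG H hH hout M => ?_⟩
  have hcard : Nat.card ((G.V × G.V) × (H.V × H.V)) ≤ U.depth :=
    hL ▸ natCard_pairs_le (hN G hG) (hN H hH)
  have h0 : ∀ {u v : G.V} {u' v' : H.V}, G.graph.Reachable u v → H.graph.Reachable u' v' →
      U.spRep G.graph (initRep K G) U.depth u v = U.spRep H.graph (initRep K H) U.depth u' v' →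
      initRep K G u v = initRep K H u' v' := hU.init_eq_of_spRep_eq
  have hS : IsSparseStable G.graph H.graph (U.spRep G.graph (initRep K G) U.depth)
      (U.spRep H.graph (initRep K H) U.depth) :=
    { diag := fun hr hr' e => (hinit G hG H hH _ _ _ _ (h0 hr hr' e)).1
      adj := fun hr hr' e => (hinit G hG H hH _ _ _ _ (h0 hr hr' e)).2
      stable := hU.spRep_stable hcard }
  have hdiag := CoSparsifiedGNN.diag_map_eq_of_out_eq hc hΨ hne hout
  exact (hS.isBlockStable (hS.spRep_swap h0 _ _)).standardGNN_out_eq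
    (map_eq_map_of_map_eq hdiag fun u _ u' _ e => Prod.ext e e)
    (fun hr hr' e => h0 hr hr' (Prod.mk.inj e).1) M

end Dominating

theorem theorem1_general {dx de K N : ℕ} {𝒢 : Set (AttrGraph dx de)}
    (hN : ∀ G ∈ 𝒢, Fintype.card G.V ≤ N) (hinit : ConsistentInit K 𝒢)
    (R : AttrGraph dx de → AttrGraph dx de → Prop) :
    (∃ M : CoSparsifiedGNN dx de K, ∀ G ∈ 𝒢, ∀ H ∈ 𝒢, R G H → M.out G ≠ M.out H) ↔
      ∃ M : StandardGNN dx de K, ∀ G ∈ 𝒢, ∀ H ∈ 𝒢, R G H → M.out G ≠ M.out H := by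
  obtain ⟨S, hS⟩ := exists_standardGNN_dominating hN hinit
  obtain ⟨C, hC⟩ := exists_coSparsifiedGNN_dominating hN hinit
  exact ⟨fun ⟨M, hM⟩ => ⟨S, fun G hG H hH hR e => hM G hG H hH hR (hS G hG H hH e M)⟩,
    fun ⟨M, hM⟩ => ⟨C, fun G hG H hH hR e => hM G hG H hH hR (hC G hG H hH e M)⟩⟩

theorem theorem1 {dx de K : ℕ} (𝒢 : Set (AttrGraph dx de)) (N : ℕ)
    (hN : ∀ G ∈ 𝒢, Fintype.card G.V ≤ N) (hinit : ConsistentInit K 𝒢) :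
    (∀ (W : Type) [Finite W] (Q : SimpleGraph W),
      (∃ M : CoSparsifiedGNN dx de K, Detects M.out Q 𝒢) ↔
        ∃ M : StandardGNN dx de K, Detects M.out Q 𝒢) ∧
    ∀ G ∈ 𝒢, ∀ H ∈ 𝒢,
      (∃ M : CoSparsifiedGNN dx de K, M.out G ≠ M.out H) ↔
        ∃ M : StandardGNN dx de K, M.out G ≠ M.out H := by
  refine ⟨fun W _ Q => ?_, fun G hG H hH => ?_⟩
  · simpa only [Detects, and_imp] using theorem1_general hN hinit
      fun G H => Q.IsContained G.graph ∧ ¬ Q.IsContained H.graph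
  · have hGH {α : Type} (z : AttrGraph dx de → α) :
        (∀ A ∈ 𝒢, ∀ B ∈ 𝒢, A = G ∧ B = H → z A ≠ z B) ↔ z G ≠ z H :=
      ⟨fun h => h G hG H hH ⟨rfl, rfl⟩, by rintro h A - B - ⟨rfl, rfl⟩; exact h⟩
    simpa only [hGH] using theorem1_general hN hinit fun A B => A = G ∧ B = H
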